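/- Let $1<\alpha<2$ and $\lambda\ge 0$, and let $u\in C^7(\mathbb R)$ be real-valued with $u^{(k)}\in L^1(\mathbb R)$ for $k=0,1,\dots,7$. Let $${}_{-\infty}D_x^{\alpha,\lambda}u(x)=\frac{e^{-\lambda x}}{\Gamma(2-\alpha)}\frac{d^2}{dx^2}\int_{-\infty}^x (x-s)^{1-\alpha}e^{\lambda s}u(s)\,ds$$ be the left tempered Riemann--Liouville derivative of order $\alpha$. For $h>0$ and $p\in\mathbb Z$ let $$\Delta_p^{\alpha,\lambda}u(x)=\frac1{h^\alpha}\sum_{k=0}^\infty g_k^{(\alpha)}e^{-(k-p)\lambda h}u(x-(k-p)h),\qquad g_k^{(\alpha)}=\frac{\Gamma(k-\alpha)}{\Gamma(-\alpha)\Gamma(k+1)},$$ be the left shifted tempered Grünwald--Letnikov operators. Put $\delta_x^2f(x)=\big(f(x-h)-2f(x)+f(x+h)\big)/h^2$, $$b_2^\alpha=\frac{4+\alpha-\alpha^2}{24},\quad \mu_1=\frac{(1+\alpha)(2+\alpha)}{12},\quad \mu_0=-\frac{(-2+\alpha)(2+\alpha)}{6},\quad \mu_{-1}=\frac{(-2+\alpha)(-1+\alpha)}{12},$$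 and $P_x^\lambda v(x)=v(x)+h^2b_2^\alpha e^{-\lambda x}\,\delta_x^2\big(e^{\lambda x}v(x)\big)$. Then the integral defining ${}_{-\infty}D_x^{\alpha,\lambda}u$ converges absolutely for every $x$ and is a twice differentiable function of $x\in\mathbb R$, the series defining $\Delta_p^{\alpha,\lambda}u(x)$ converges absolutely for all $p\in\mathbb Z$, $h>0$, $x\in\mathbb R$, and, as $h\to0^+$, $$P_x^\lambda\,{}_{-\infty}D_x^{\alpha,\lambda}u(x)=\mu_1\Delta_1^{\alpha,\lambda}u(x)+\mu_0\Delta_0^{\alpha,\lambda}u(x)+\mu_{-1}\Delta_{-1}^{\alpha,\lambda}u(x)+O(h^4)$$ uniformly in $x\in\mathbb R$; that is, there are $C$ and $h_0>0$, depending only on $u,\alpha,\lambda$, such that the difference of the two sides is at most $Ch^4$ in absolute value for all $0<h\le h_0$ and all $x\in\mathbb R$. -/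

import Mathlib

open MeasureTheory

noncomputable section

/-- The integer `n` with `n - 1 < α < n` (for non-integer `α > 0`). -/
def rlOrder (α : ℝ) : ℕ := ⌊α⌋₊ + 1

/-- The integrand `s ↦ (x - s)^(n - α - 1) f(s)` of the left Riemann-Liouville derivative. -/
def rlIntegrand (α : ℝ) (f : ℝ → ℝ) (x s : ℝ) : ℝ :=
  (x - s) ^ ((rlOrder α : ℝ) - α - 1) * f s

/-- The function `x ↦ ∫_{-∞}^x (x - s)^(n - α - 1) f(s) ds`. -/
def rlIntegral (α : ℝ) (f : ℝ → ℝ) (x : ℝ) : ℝ :=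
  ∫ s in Set.Iic x, rlIntegrand α f x s

/-- The left Riemann-Liouville derivative of order `α` on the whole line,
`(1 / Γ(n - α)) dⁿ/dxⁿ ∫_{-∞}^x (x - s)^(n - α - 1) f(s) ds`. -/
def leftRL (α : ℝ) (f : ℝ → ℝ) (x : ℝ) : ℝ :=
  1 / Real.Gamma ((rlOrder α : ℝ) - α) * iteratedDeriv (rlOrder α) (rlIntegral α f) x

/-- The left Riemann-Liouville derivative of `f` of order `α` exists at every point: the integrals
converge absolutely and the resulting function is `n` times differentiable. -/
def LeftRLExists (α : ℝ) (f : ℝ → ℝ) : Prop :=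
  (∀ x : ℝ, IntegrableOn (rlIntegrand α f x) (Set.Iic x)) ∧
    ∀ m < rlOrder α, Differentiable ℝ (iteratedDeriv m (rlIntegral α f))

/-- Multiplication by the exponential: `x ↦ e^{λ x} f(x)`. -/
def expMul (lam : ℝ) (f : ℝ → ℝ) (x : ℝ) : ℝ := Real.exp (lam * x) * f x

/-- The left tempered Riemann-Liouville derivative `e^{-λ x} D^α (e^{λ x} u(x))`. -/
def leftTemperedRL (α lam : ℝ) (u : ℝ → ℝ) (x : ℝ) : ℝ :=
  Real.exp (-lam * x) * leftRL α (expMul lam u) x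

/-- The Grünwald weights `Γ(k - α) / (Γ(-α) Γ(k + 1))`. -/
def grunwaldWeight (α : ℝ) (k : ℕ) : ℝ :=
  Real.Gamma ((k : ℝ) - α) / (Real.Gamma (-α) * Real.Gamma ((k : ℝ) + 1))

/-- The `k`-th term `g_k e^{-(k - p) λ h} u(x - (k - p) h)` of the shifted tempered Grünwald sum. -/
def grunwaldTerm (α lam h : ℝ) (p : ℤ) (u : ℝ → ℝ) (x : ℝ) (k : ℕ) : ℝ :=
  grunwaldWeight α k * Real.exp (-((k : ℝ) - (p : ℝ)) * lam * h) * u (x - ((k : ℝ) - (p : ℝ)) * h)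

/-- The left shifted tempered Grünwald-Letnikov operator with step `h` and shift `p`. -/
def temperedGrunwald (α lam h : ℝ) (p : ℤ) (u : ℝ → ℝ) (x : ℝ) : ℝ :=
  1 / h ^ α * ∑' k : ℕ, grunwaldTerm α lam h p u x k

/-- The centered second difference operator with step `h`. -/
def centeredDiff (h : ℝ) (f : ℝ → ℝ) (x : ℝ) : ℝ :=
  (f (x - h) - 2 * f x + f (x + h)) / h ^ 2

def coeffB (α : ℝ) : ℝ := (4 + α - α ^ 2) / 24

def coeffMuOne (α : ℝ) : ℝ := (1 + α) * (2 + α) / 12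

def coeffMuZero (α : ℝ) : ℝ := -(-2 + α) * (2 + α) / 6

def coeffMuNegOne (α : ℝ) : ℝ := (-2 + α) * (-1 + α) / 12

/-- The tempered quasi-compact operator `P^λ v = v + h² b e^{-λ x} δ² (e^{λ x} v)`. -/
def temperedP (α lam h : ℝ) (v : ℝ → ℝ) (x : ℝ) : ℝ :=
  v x + h ^ 2 * coeffB α * Real.exp (-lam * x) * centeredDiff h (expMul lam v) x

end

/-! ### Laplace transform of powers on the right half-plane. -/

noncomputable section

/-! Fourier inversion gives `e^{λx} u(x) = ∫ û(ω) e^{zx} dω` with `z = λ + 2πiω`, and on this line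
every operator is a multiplier. The tempered integral of order `2 - α` contributes `Γ(2 - α)
z^{α-2}` (`tempered_integral_eq`), so two derivatives give `z^α`. The generating function of the
weights (`hasSum_grunwaldWeight_mul_pow`) turns `Δ_p` into `h^{-α} e^{pzh} (1 - e^{-zh})^α`, and `P`
becomes `1 + b (e^{zh} - 2 + e^{-zh})`. Hence the error, times `e^{λx}`, has multiplier `h^{-α}
Q(zh)` with `Q = quasiCompactSymbol α` (`exp_mul_error`).

The heart is `|Q(ζ)| ≤ C |ζ|^{α+4}` on the strip `0 ≤ Re ζ ≤ λ` (`quasiCompactSymbol_bound`). Near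
`0`, `1 - e^{-ζ} = ζ e^{-ζ/2} (1 + w)` with `w = ζ²/24 + O(ζ⁴)`, and the coefficients make all terms
of `Q / ζ^α` below order four cancel.

The error is then at most `C h⁴ ∫ |z|^{α+4} |û|`, because `|e^{zx}| = e^{λx}` cancels. Seven
integrable derivatives give `û = O((1 + |ω|)^{-7})`, and `α + 4 < 6` makes the integral finite. -/

open Complex in
/-- The Laplace transform of the power `t ^ (s - 1)` on the right half-plane. -/
theorem integral_rpow_mul_cexp_neg_mul_Ioi {s : ℝ} (hs : 0 < s) {r : ℂ} (hr : 0 < r.re) :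
    ∫ t in Set.Ioi (0 : ℝ), ((t ^ (s - 1) : ℝ) : ℂ) * cexp (-(r * t)) =
      Real.Gamma s * r ^ (-(s : ℂ)) := by
  have hint : ∀ (c : ℝ) (q : ℝ), -1 < q → 0 < c →
      IntegrableOn (fun t : ℝ => t ^ q * Real.exp (-c * t)) (Set.Ioi 0) := by
    intro c q hq hc
    simpa using integrableOn_rpow_mul_exp_neg_mul_rpow (s := q) (p := 1) hq zero_lt_one hc
  have hmeas : ∀ r : ℂ, Measurable (fun t : ℝ => ((t ^ (s - 1) : ℝ) : ℂ) * cexp (-(r * t))) := by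
    intro r; fun_prop
  have hU : IsOpen {r : ℂ | 0 < r.re} := isOpen_lt continuous_const continuous_re
  have hnorm : ∀ (r : ℂ) (t : ℝ), ‖cexp (-(r * t))‖ = Real.exp (-r.re * t) := by
    intro r t; rw [norm_exp]; simp
  -- Both sides are holomorphic for `Re r > 0` and agree for real `r`, so the identity theorem
  -- extends the real Gamma integral. Local domination uses `Re r > Re r₀ / 2`.
  have hd : DifferentiableOn ℂ (fun r : ℂ => ∫ t in Set.Ioi (0 : ℝ),
      ((t ^ (s - 1) : ℝ) : ℂ) * cexp (-(r * t))) {r | 0 < r.re} := by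
    intro r₀ hr₀
    have hr₀' : 0 < r₀.re := hr₀
    refine ((hasDerivAt_integral_of_dominated_loc_of_deriv_le
      (bound := fun t : ℝ => t ^ s * Real.exp (-(r₀.re / 2) * t))
      (F' := fun r t => ((t ^ (s - 1) : ℝ) : ℂ) * (cexp (-(r * t)) * (-t)))
      (s := {r : ℂ | r₀.re / 2 < r.re})
      ((isOpen_lt continuous_const continuous_re).mem_nhds
        (show r₀.re / 2 < r₀.re by linarith)) ?_ ?_ ?_ ?_ ?_ ?_).2).differentiableAt.differentiableWithinAt
    · exact Filter.Eventually.of_forall fun r => (hmeas r).aestronglyMeasurable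
    · refine (hint r₀.re (s - 1) (by linarith) hr₀').mono' (hmeas r₀).aestronglyMeasurable ?_
      refine (ae_restrict_iff' measurableSet_Ioi).2 (Filter.Eventually.of_forall fun t ht => ?_)
      rw [norm_mul, hnorm, norm_real, Real.norm_of_nonneg (Real.rpow_nonneg (le_of_lt ht) _)]
    · have : Measurable (fun t : ℝ => ((t ^ (s - 1) : ℝ) : ℂ) * (cexp (-(r₀ * t)) * (-t))) := by
        fun_prop
      exact this.aestronglyMeasurable
    · refine (ae_restrict_iff' measurableSet_Ioi).2 (Filter.Eventually.of_forall fun t ht r hr => ?_)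
      have ht' : (0 : ℝ) < t := ht
      have hr' : r₀.re / 2 < r.re := hr
      rw [norm_mul, norm_mul, hnorm, norm_real, norm_neg, norm_real,
        Real.norm_of_nonneg (Real.rpow_nonneg ht'.le _), Real.norm_of_nonneg ht'.le]
      have h1 : t ^ s = t ^ (s - 1) * t := by
        rw [← Real.rpow_add_one ht'.ne']; ring_nf
      have h2 : Real.exp (-r.re * t) ≤ Real.exp (-(r₀.re / 2) * t) := by
        apply Real.exp_le_exp.2; nlinarith
      rw [h1]
      calc t ^ (s - 1) * (Real.exp (-r.re * t) * t)
          = t ^ (s - 1) * t * Real.exp (-r.re * t) := by ring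
        _ ≤ _ := by gcongr
    · exact hint (r₀.re / 2) s (by linarith) (by linarith)
    · refine Filter.Eventually.of_forall fun t r _ => ?_
      have h : HasDerivAt (fun r : ℂ => -(r * t)) (-(t : ℂ)) r := by
        have h := ((hasDerivAt_id r).mul_const (t : ℂ)).neg
        rw [one_mul] at h
        exact h
      exact h.cexp.const_mul _
  have hd2 : DifferentiableOn ℂ (fun r : ℂ => (Real.Gamma s : ℂ) * r ^ (-(s : ℂ))) {r | 0 < r.re} := by
    intro r hr
    exact ((differentiableAt_id.cpow (differentiableAt_const _)
      (Or.inl hr)).const_mul _).differentiableWithinAt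
  have hconv : IsPreconnected {r : ℂ | 0 < r.re} := (convex_halfSpace_re_gt 0).isPreconnected
  have hreal : ∀ c : ℝ, 0 < c → (∫ t in Set.Ioi (0 : ℝ), ((t ^ (s - 1) : ℝ) : ℂ) *
      cexp (-((c : ℂ) * t))) = Real.Gamma s * (c : ℂ) ^ (-(s : ℂ)) := by
    intro c hc
    have h := Real.integral_rpow_mul_exp_neg_mul_Ioi hs hc
    have h2 : (∫ t in Set.Ioi (0 : ℝ), ((t ^ (s - 1) : ℝ) : ℂ) * cexp (-((c : ℂ) * t))) =
        ((∫ t in Set.Ioi (0 : ℝ), t ^ (s - 1) * Real.exp (-(c * t)) : ℝ) : ℂ) := by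
      rw [← integral_complex_ofReal]
      congr 1; ext t; push_cast; rfl
    rw [h2, h, one_div, Real.inv_rpow hc.le, ← Real.rpow_neg hc.le, ofReal_mul,
      ofReal_cpow hc.le, ofReal_neg, mul_comm]
  have hfreq : ∃ᶠ c in nhdsWithin (1 : ℂ) {1}ᶜ, (∫ t in Set.Ioi (0 : ℝ), ((t ^ (s - 1) : ℝ) : ℂ) *
      cexp (-(c * t))) = Real.Gamma s * c ^ (-(s : ℂ)) := by
    have ht : Filter.Tendsto (fun c : ℝ => (c : ℂ)) (nhdsWithin 1 (Set.Ioi 1))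
        (nhdsWithin (1 : ℂ) {1}ᶜ) := by
      refine tendsto_nhdsWithin_iff.2 ⟨?_, ?_⟩
      · exact (continuous_ofReal.tendsto' 1 1 (by simp)).mono_left nhdsWithin_le_nhds
      · filter_upwards [self_mem_nhdsWithin] with c hc
        have hc' : (1 : ℝ) < c := hc
        simp only [Set.mem_compl_iff, Set.mem_singleton_iff]
        exact_mod_cast hc'.ne'
    refine ht.frequently (Filter.Eventually.frequently ?_)
    filter_upwards [self_mem_nhdsWithin] with c hc
    exact hreal c (lt_trans zero_lt_one hc)
  exact (hd.analyticOnNhd hU).eqOn_of_preconnected_of_frequently_eq (hd2.analyticOnNhd hU) hconv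
    (show (1 : ℂ) ∈ {r : ℂ | 0 < r.re} by simp) hfreq hr

end

/-! ### Grünwald weights and their generating function. -/

noncomputable section

theorem natCast_sub_ne_zero {α : ℝ} (hα1 : 1 < α) (hα2 : α < 2) (k : ℕ) :
    (k : ℝ) - α ≠ 0 := by
  intro h
  have hk : (k : ℝ) = α := by linarith
  have h1 : (1 : ℝ) < k := hk ▸ hα1
  have h2 : (k : ℝ) < 2 := hk ▸ hα2
  have h1' : 1 < k := by exact_mod_cast h1
  have h2' : k < 2 := by exact_mod_cast h2
  omega

theorem grunwaldWeight_zero {α : ℝ} (hα1 : 1 < α) (hα2 : α < 2) : grunwaldWeight α 0 = 1 := by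
  have : Real.Gamma (-α) ≠ 0 := by
    refine Real.Gamma_ne_zero fun m hm => natCast_sub_ne_zero hα1 hα2 m ?_
    linarith
  simp [grunwaldWeight, this]

theorem grunwaldWeight_succ {α : ℝ} (hα1 : 1 < α) (hα2 : α < 2) (k : ℕ) :
    grunwaldWeight α (k + 1) * (k + 1) = grunwaldWeight α k * (k - α) := by
  have h1 : Real.Gamma (-α) ≠ 0 := by
    refine Real.Gamma_ne_zero fun m hm => natCast_sub_ne_zero hα1 hα2 m ?_
    linarith
  have h2 : Real.Gamma ((k : ℝ) + 1) ≠ 0 := (Real.Gamma_pos_of_pos (by positivity)).ne'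
  have h3 : (k : ℝ) + 1 ≠ 0 := by positivity
  unfold grunwaldWeight
  have e1 : (((k + 1 : ℕ) : ℝ) - α) = ((k : ℝ) - α) + 1 := by push_cast; ring
  rw [e1, Real.Gamma_add_one (natCast_sub_ne_zero hα1 hα2 k)]
  push_cast
  rw [Real.Gamma_add_one h3]
  field_simp

/-- Both sides satisfy the same first-order recurrence; the binomial form gives access to the
binomial series. -/
theorem grunwaldWeight_eq_choose {α : ℝ} (hα1 : 1 < α) (hα2 : α < 2) (k : ℕ) :
    grunwaldWeight α k = (-1) ^ k * Ring.choose α k := by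
  induction k with
  | zero => simp [grunwaldWeight_zero hα1 hα2]
  | succ k ih =>
    have h := grunwaldWeight_succ hα1 hα2 k
    have h3 : (k : ℝ) + 1 ≠ 0 := by positivity
    have h4 : Ring.choose α (k + 1) * (k + 1) = Ring.choose α k * (α - k) := by
      have a1 := Ring.descPochhammer_eq_factorial_smul_choose α (k + 1)
      have a2 := Ring.descPochhammer_eq_factorial_smul_choose α k
      rw [descPochhammer_succ_right, Polynomial.smeval_mul, a2] at a1
      have hf : (k.factorial : ℝ) ≠ 0 := by exact_mod_cast k.factorial_ne_zero
      simp only [nsmul_eq_mul, Nat.factorial_succ, Polynomial.smeval_sub, Polynomial.smeval_X,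
        Polynomial.smeval_natCast, pow_one, pow_zero, mul_one] at a1
      push_cast at a1
      have : (k.factorial : ℝ) * (Ring.choose α (k + 1) * (k + 1)) =
        k.factorial * (Ring.choose α k * (α - k)) := by linarith
      exact mul_left_cancel₀ hf this
    rw [ih] at h
    apply mul_right_cancel₀ h3
    rw [h, mul_assoc ((-1) ^ (k + 1)), h4]
    ring

/-- From index 2 on the weights are nonnegative, and the recurrence reads `α g_k = k g_k - (k + 1)
g_{k+1}`. The partial sums telescope and stay below `2 g_2 / α`. -/
theorem summable_grunwaldWeight {α : ℝ} (hα1 : 1 < α) (hα2 : α < 2) :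
    Summable (fun k => |grunwaldWeight α k|) := by
  have hpos : ∀ k : ℕ, 0 ≤ grunwaldWeight α (k + 2) := by
    intro k
    unfold grunwaldWeight
    have : Real.Gamma (-α) = Real.Gamma (2 - α) / ((-α) * (1 - α)) := by
      have a1 := Real.Gamma_add_one (show -α ≠ 0 by linarith)
      have a2 := Real.Gamma_add_one (show 1 - α ≠ 0 by linarith)
      rw [show -α + 1 = 1 - α by ring] at a1
      rw [show 1 - α + 1 = 2 - α by ring, a1] at a2
      rw [a2]
      have : -α ≠ 0 := by linarith
      have : 1 - α ≠ 0 := by linarith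
      field_simp
    have h1 : 0 < Real.Gamma (-α) := by
      rw [this]
      exact div_pos (Real.Gamma_pos_of_pos (by linarith)) (by nlinarith)
    have h2 : 0 < Real.Gamma (((k + 2 : ℕ) : ℝ) - α) := by
      apply Real.Gamma_pos_of_pos
      push_cast
      have : (0 : ℝ) ≤ k := k.cast_nonneg
      linarith
    have h3 : 0 < Real.Gamma (((k + 2 : ℕ) : ℝ) + 1) := Real.Gamma_pos_of_pos (by positivity)
    positivity
  have hsum : ∀ n : ℕ, α * ∑ k ∈ Finset.range n, grunwaldWeight α (k + 2) =
      2 * grunwaldWeight α 2 - (n + 2) * grunwaldWeight α (n + 2) := by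
    intro n
    induction n with
    | zero => simp
    | succ n ih =>
      have h := grunwaldWeight_succ hα1 hα2 (n + 2)
      rw [Finset.sum_range_succ, mul_add, ih]
      push_cast at h ⊢
      rw [show n + 1 + 2 = n + 2 + 1 by ring]
      linarith
  rw [← summable_nat_add_iff 2]
  refine summable_of_sum_range_le (c := 2 * grunwaldWeight α 2 / α) (fun n => abs_nonneg _) fun n => ?_
  have h1 : ∑ k ∈ Finset.range n, |grunwaldWeight α (k + 2)| =
      ∑ k ∈ Finset.range n, grunwaldWeight α (k + 2) :=
    Finset.sum_congr rfl fun k _ => abs_of_nonneg (hpos k)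
  rw [h1, le_div_iff₀ (by linarith), mul_comm, hsum n]
  have := hpos n
  nlinarith [(Nat.cast_nonneg n : (0 : ℝ) ≤ n)]

/-- The generating function of the Grünwald weights on the closed unit disc. -/
theorem hasSum_grunwaldWeight_mul_pow {α : ℝ} (hα1 : 1 < α) (hα2 : α < 2) {w : ℂ} (hw : ‖w‖ ≤ 1) :
    HasSum (fun k => (grunwaldWeight α k : ℂ) * w ^ k) ((1 - w) ^ (α : ℂ)) := by
  have hsumm : ∀ w : ℂ, ‖w‖ ≤ 1 → Summable (fun k => (grunwaldWeight α k : ℂ) * w ^ k) := by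
    intro w hw
    refine Summable.of_norm_bounded (summable_grunwaldWeight hα1 hα2) fun k => ?_
    rw [norm_mul, norm_pow, Complex.norm_real, Real.norm_eq_abs]
    exact mul_le_of_le_one_right (abs_nonneg _) (pow_le_one₀ (norm_nonneg _) hw)
  have hopen : ∀ w : ℂ, ‖w‖ < 1 → ∑' k, (grunwaldWeight α k : ℂ) * w ^ k = (1 - w) ^ (α : ℂ) := by
    intro w hw
    have h := (Complex.one_add_cpow_hasFPowerSeriesOnBall_zero (a := (α : ℂ))).hasSum
      (y := -w) (by
        rw [← ENNReal.ofReal_one, Metric.eball_ofReal]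
        simpa using hw)
    simp only [binomialSeries_apply, zero_add] at h
    rw [← sub_eq_add_neg] at h
    rw [← h.tsum_eq]
    congr 1
    ext k
    rw [grunwaldWeight_eq_choose hα1 hα2]
    simp only [List.ofFn_const, List.prod_replicate, smul_eq_mul]
    rw [neg_pow w]
    push_cast
    ring
  suffices h : ∑' k, (grunwaldWeight α k : ℂ) * w ^ k = (1 - w) ^ (α : ℂ) by
    rw [← h]; exact (hsumm w hw).hasSum
  -- Boundary points are reached by Abel's argument: follow `r w` as `r` increases to 1. Clamping
  -- `r` to `[0, 1]` keeps the series dominated for every real `r`.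
  have hproj : ∀ r : ℝ, ‖((max 0 (min r 1) : ℝ) : ℂ) * w‖ ≤ 1 := by
    intro r
    rw [norm_mul, Complex.norm_real, Real.norm_of_nonneg (le_max_left _ _)]
    exact mul_le_one₀ (max_le zero_le_one (min_le_right _ _)) (norm_nonneg _) hw
  have hc1 : Continuous (fun r : ℝ => ∑' k, (grunwaldWeight α k : ℂ) *
      (((max 0 (min r 1) : ℝ) : ℂ) * w) ^ k) := by
    refine continuous_tsum (fun k => by fun_prop) (summable_grunwaldWeight hα1 hα2) fun k r => ?_
    rw [norm_mul, norm_pow, Complex.norm_real, Real.norm_eq_abs]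
    exact mul_le_of_le_one_right (abs_nonneg _) (pow_le_one₀ (norm_nonneg _) (hproj r))
  -- `1 - w` lies in the closed right half-plane, where `z ^ α` is continuous even at `0` because `α
  -- > 0`; this covers `w = 1`.
  have hc2 : ContinuousAt (fun r : ℝ => (1 - ((max 0 (min r 1) : ℝ) : ℂ) * w) ^ (α : ℂ)) 1 := by
    have h := Complex.continuousAt_cpow_const_of_re_pos
      (z := 1 - ((max 0 (min (1 : ℝ) 1) : ℝ) : ℂ) * w) (w := (α : ℂ))
      (Or.inl (by
        have := (Complex.abs_re_le_norm w).trans hw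
        have := (abs_le.1 this).2
        simpa using this)) (by simp; linarith)
    exact ContinuousAt.comp (f := fun r : ℝ => 1 - ((max 0 (min r 1) : ℝ) : ℂ) * w) h
      (by fun_prop)
  have h1 := (hc1.tendsto 1).mono_left (nhdsWithin_le_nhds (s := Set.Iio 1))
  have h2 := hc2.tendsto.mono_left (nhdsWithin_le_nhds (s := Set.Iio 1))
  have h3 : (fun r : ℝ => ∑' k, (grunwaldWeight α k : ℂ) * (((max 0 (min r 1) : ℝ) : ℂ) * w) ^ k)
      =ᶠ[nhdsWithin 1 (Set.Iio 1)] fun r : ℝ => (1 - ((max 0 (min r 1) : ℝ) : ℂ) * w) ^ (α : ℂ) := by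
    filter_upwards [self_mem_nhdsWithin] with r hr
    have hr' : r < 1 := hr
    apply hopen
    rw [norm_mul, Complex.norm_real, Real.norm_of_nonneg (le_max_left _ _)]
    have : max 0 (min r 1) < 1 := max_lt zero_lt_one (lt_of_le_of_lt (min_le_left _ _) hr')
    calc max 0 (min r 1) * ‖w‖ ≤ max 0 (min r 1) * 1 := by gcongr
      _ < 1 := by linarith
  have h4 := tendsto_nhds_unique (h1.congr' h3) h2
  simpa using h4

end

/-! ### Fourth-order estimate of the scheme symbol. -/

noncomputable section

open Asymptotics Filter Topology in
theorem cexp_mul_sub_sum_isBigO (c : ℂ) {n : ℕ} (hn : 0 < n) :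
    (fun ζ : ℂ => Complex.exp (c * ζ) - ∑ m ∈ Finset.range n, (c * ζ) ^ m / m.factorial)
      =O[𝓝 0] fun ζ : ℂ => ζ ^ n := by
  have hc : Tendsto (fun ζ : ℂ => ‖c * ζ‖) (𝓝 0) (𝓝 0) := by
    have : Continuous (fun ζ : ℂ => ‖c * ζ‖) := by fun_prop
    simpa using this.tendsto 0
  refine IsBigO.of_bound (‖c‖ ^ n * (n.succ * ((n.factorial : ℝ) * n)⁻¹)) ?_
  filter_upwards [hc.eventually (ge_mem_nhds zero_lt_one)] with ζ hζ
  have h := Complex.exp_bound hζ hn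
  rw [norm_mul, mul_pow] at h
  rw [norm_pow]
  linarith

/-- The Fourier symbol of the quasi-compact scheme error, with unit step. -/
def quasiCompactSymbol (α : ℝ) (ζ : ℂ) : ℂ :=
  ζ ^ (α : ℂ) * (1 + coeffB α * (Complex.exp ζ - 2 + Complex.exp (-ζ))) -
    (coeffMuOne α * Complex.exp ζ + coeffMuZero α + coeffMuNegOne α * Complex.exp (-ζ)) *
      (1 - Complex.exp (-ζ)) ^ (α : ℂ)

/-- The relative deviation of `2 sinh (ζ / 2)` from `ζ`. -/
def sinhcDeviation (ζ : ℂ) : ℂ := (Complex.exp (1 / 2 * ζ) - Complex.exp (-1 / 2 * ζ)) / ζ - 1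

open Asymptotics Filter Topology

theorem pow_isBigO_pow_nhds_zero {m n : ℕ} (h : m ≤ n) :
    (fun ζ : ℂ => ζ ^ n) =O[𝓝 0] fun ζ : ℂ => ζ ^ m := by
  refine IsBigO.of_bound 1 ?_
  filter_upwards [Metric.ball_mem_nhds (0 : ℂ) one_pos] with ζ hζ
  have hζ' : ‖ζ‖ < 1 := by simpa using hζ
  rw [norm_pow, norm_pow, one_mul]
  exact pow_le_pow_of_le_one (norm_nonneg _) hζ'.le h

/-- Even Taylor terms cancel in `e^{ζ/2} - e^{-ζ/2}`, so a remainder of order five, divided by `ζ`,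
leaves order four. -/
theorem sinhcDeviation_isBigO :
    (fun ζ : ℂ => sinhcDeviation ζ - ζ ^ 2 / 24) =O[𝓝[≠] 0] fun ζ : ℂ => ζ ^ 4 := by
  have h1 := cexp_mul_sub_sum_isBigO (1 / 2) (n := 5) (by norm_num)
  have h2 := cexp_mul_sub_sum_isBigO (-1 / 2) (n := 5) (by norm_num)
  have h3 := ((h1.sub h2).mono (nhdsWithin_le_nhds (s := {0}ᶜ))).mul
    (isBigO_refl (fun ζ : ℂ => ζ⁻¹) _)
  refine h3.congr' ?_ ?_
  · filter_upwards [self_mem_nhdsWithin] with ζ hζ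
    have hζ' : ζ ≠ 0 := hζ
    unfold sinhcDeviation
    simp only [Finset.sum_range_succ, Finset.sum_range_zero, Nat.factorial]
    field_simp
    push_cast
    ring
  · filter_upwards [self_mem_nhdsWithin] with ζ hζ
    have hζ' : ζ ≠ 0 := hζ
    field_simp

theorem sinhcDeviation_isBigO_sq :
    sinhcDeviation =O[𝓝[≠] 0] fun ζ : ℂ => ζ ^ 2 := by
  have h1 : (fun ζ : ℂ => ζ ^ 4) =O[𝓝[≠] 0] fun ζ : ℂ => ζ ^ 2 :=
    (pow_isBigO_pow_nhds_zero (by norm_num)).mono nhdsWithin_le_nhds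
  have h2 : (fun ζ : ℂ => ζ ^ 2 / 24) =O[𝓝[≠] 0] fun ζ : ℂ => ζ ^ 2 := by
    simpa [div_eq_inv_mul] using (isBigO_refl (fun ζ : ℂ => ζ ^ 2) (𝓝[≠] 0)).const_mul_left (24⁻¹)
  simpa using (sinhcDeviation_isBigO.trans h1).add h2

theorem sinhcDeviation_tendsto : Tendsto sinhcDeviation (𝓝[≠] 0) (𝓝 0) := by
  refine sinhcDeviation_isBigO_sq.trans_tendsto ?_
  have : Continuous (fun ζ : ℂ => ζ ^ 2) := by fun_prop
  simpa using (this.tendsto 0).mono_left (nhdsWithin_le_nhds (s := {0}ᶜ))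

theorem clog_one_add_sub_isBigO :
    (fun w : ℂ => Complex.log (1 + w) - w) =O[𝓝 0] fun w : ℂ => w ^ 2 := by
  refine IsBigO.of_bound 1 ?_
  filter_upwards [Metric.ball_mem_nhds (0 : ℂ) (show (0 : ℝ) < 1 / 2 by norm_num)] with w hw
  have hw' : ‖w‖ < 1 / 2 := by simpa using hw
  have h := Complex.norm_log_one_add_sub_self_le (z := w) (by linarith)
  have h2 : (1 - ‖w‖)⁻¹ ≤ 2 := by
    rw [inv_le_comm₀ (by linarith) (by norm_num)]; linarith
  rw [norm_pow]
  nlinarith [sq_nonneg ‖w‖]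

theorem cexp_sub_one_sub_isBigO :
    (fun w : ℂ => Complex.exp w - 1 - w) =O[𝓝 0] fun w : ℂ => w ^ 2 := by
  refine IsBigO.of_bound 1 ?_
  filter_upwards [Metric.ball_mem_nhds (0 : ℂ) (show (0 : ℝ) < 1 by norm_num)] with w hw
  have hw' : ‖w‖ < 1 := by simpa using hw
  rw [norm_pow, one_mul]
  exact Complex.norm_exp_sub_one_sub_id_le hw'.le

/-- Expansion of the power of the symmetric part of `1 - exp (-ζ)`. -/
theorem sinhc_power_isBigO (α : ℂ) :
    (fun ζ : ℂ => Complex.exp (α * Complex.log (1 + sinhcDeviation ζ)) - (1 + α / 24 * ζ ^ 2))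
      =O[𝓝[≠] 0] fun ζ : ℂ => ζ ^ 4 := by
  have hw2 : (fun ζ => sinhcDeviation ζ ^ 2) =O[𝓝[≠] 0] fun ζ : ℂ => ζ ^ 4 := by
    simpa [← pow_mul] using sinhcDeviation_isBigO_sq.pow 2
  have hlog : (fun ζ => Complex.log (1 + sinhcDeviation ζ) - sinhcDeviation ζ)
      =O[𝓝[≠] 0] fun ζ : ℂ => ζ ^ 4 :=
    (clog_one_add_sub_isBigO.comp_tendsto sinhcDeviation_tendsto).trans hw2
  have h42 : (fun ζ : ℂ => ζ ^ 4) =O[𝓝[≠] 0] fun ζ : ℂ => ζ ^ 2 :=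
    (pow_isBigO_pow_nhds_zero (by norm_num)).mono nhdsWithin_le_nhds
  have hlog2 : (fun ζ => α * Complex.log (1 + sinhcDeviation ζ)) =O[𝓝[≠] 0]
      fun ζ : ℂ => ζ ^ 2 := by
    have := (hlog.trans h42).add sinhcDeviation_isBigO_sq
    simpa using this.const_mul_left α
  have hlogt : Tendsto (fun ζ => α * Complex.log (1 + sinhcDeviation ζ)) (𝓝[≠] 0) (𝓝 0) := by
    refine hlog2.trans_tendsto ?_
    have : Continuous (fun ζ : ℂ => ζ ^ 2) := by fun_prop
    simpa using (this.tendsto 0).mono_left (nhdsWithin_le_nhds (s := {0}ᶜ))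
  have hexp : (fun ζ => Complex.exp (α * Complex.log (1 + sinhcDeviation ζ)) - 1 -
      α * Complex.log (1 + sinhcDeviation ζ)) =O[𝓝[≠] 0] fun ζ : ℂ => ζ ^ 4 := by
    refine (cexp_sub_one_sub_isBigO.comp_tendsto hlogt).trans ?_
    simpa [← pow_mul, Function.comp_def] using hlog2.pow 2
  have := (hexp.add (hlog.const_mul_left α)).add (sinhcDeviation_isBigO.const_mul_left α)
  refine this.congr_left fun ζ => ?_
  ring

/-- Factorisation of the principal power of `1 - exp (-ζ)` near the origin. -/
theorem one_sub_cexp_neg_cpow (α : ℂ) :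
    ∀ᶠ ζ in 𝓝[≠] (0 : ℂ), 0 ≤ ζ.re → (1 - Complex.exp (-ζ)) ^ α =
      ζ ^ α * Complex.exp (-α / 2 * ζ) *
        Complex.exp (α * Complex.log (1 + sinhcDeviation ζ)) := by
  have hlogt : Tendsto (fun ζ => Complex.log (1 + sinhcDeviation ζ)) (𝓝[≠] 0) (𝓝 0) := by
    have h : ContinuousAt Complex.log 1 := continuousAt_clog (by simp)
    have h2 : Tendsto (fun ζ => 1 + sinhcDeviation ζ) (𝓝[≠] 0) (𝓝 1) := by
      simpa using sinhcDeviation_tendsto.const_add 1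
    simpa [Function.comp_def] using h.tendsto.comp h2
  have hid : Tendsto (fun ζ : ℂ => ‖ζ‖) (𝓝[≠] 0) (𝓝 0) := by
    simpa using (continuous_norm.tendsto (0 : ℂ)).mono_left (nhdsWithin_le_nhds (s := {0}ᶜ))
  filter_upwards [self_mem_nhdsWithin, hlogt.norm.eventually (gt_mem_nhds (by simp : ‖(0 : ℂ)‖ < 1 / 2)),
    hid.eventually (gt_mem_nhds (zero_lt_one (α := ℝ))),
    sinhcDeviation_tendsto.norm.eventually (gt_mem_nhds (by simp : ‖(0 : ℂ)‖ < 1))] with ζ h0 hl hn hw hre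
  have hζ : ζ ≠ 0 := h0
  set w := sinhcDeviation ζ with hwdef
  have hw1 : 1 + w ≠ 0 := by
    intro h
    have : w = -1 := by linear_combination h
    rw [this] at hw
    simp at hw
  have harg := Complex.abs_arg_le_pi_div_two_iff.2 hre
  have him1 := abs_le.1 harg
  have him2 := abs_le.1 ((Complex.abs_im_le_norm (Complex.log (1 + w))).trans hl.le)
  have him3 := abs_le.1 ((Complex.abs_im_le_norm ζ).trans hn.le)
  have hfac : 1 - Complex.exp (-ζ) =
      Complex.exp (Complex.log ζ - ζ / 2 + Complex.log (1 + w)) := by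
    rw [Complex.exp_add, Complex.exp_sub, Complex.exp_log hζ, Complex.exp_log hw1, hwdef,
      sinhcDeviation, add_sub_cancel]
    have e1 : Complex.exp (-ζ) = Complex.exp (-1 / 2 * ζ) / Complex.exp (ζ / 2) := by
      rw [← Complex.exp_sub]; congr 1; ring
    have e2 : Complex.exp (1 / 2 * ζ) = Complex.exp (ζ / 2) := by congr 1; ring
    rw [e1, e2]
    field_simp
  have him : (Complex.log ζ - ζ / 2 + Complex.log (1 + w)).im =
      ζ.arg - ζ.im / 2 + (Complex.log (1 + w)).im := by
    rw [Complex.add_im, Complex.sub_im, Complex.log_im]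
    congr 2
    rw [show ζ / 2 = ζ / ((2 : ℝ) : ℂ) by norm_num, Complex.div_ofReal_im]
  -- The exponent in `hfac` has imaginary part at most `π/2 + 1/2 + 1/2 < π` in modulus, so the
  -- principal logarithm returns it unchanged. The bound `π/2` on the argument is where `0 ≤ Re ζ`
  -- enters.
  have hpi := Real.pi_gt_three
  have hne : 1 - Complex.exp (-ζ) ≠ 0 := by rw [hfac]; exact Complex.exp_ne_zero _
  rw [Complex.cpow_def_of_ne_zero hne, Complex.cpow_def_of_ne_zero hζ, hfac,
    Complex.log_exp (by rw [him]; linarith [him1.1, him2.1, him3.2])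
      (by rw [him]; linarith [him1.2, him2.2, him3.1]), ← Complex.exp_add, ← Complex.exp_add]
  congr 1
  ring

/-- The coefficients enter here. With `ζ^α` factored out, the bracket compares `1 + b ζ²` with the
product of `1 + (4 - α²)/24 ζ²` and `1 + α/24 ζ²`, up to `O(ζ⁴)`; `b` is exactly the sum of the two
quadratic coefficients. -/
theorem quasiCompactSymbol_near_zero (α : ℝ) (hα : 0 < α) :
    ∃ r > 0, ∃ C : ℝ, ∀ ζ : ℂ, 0 ≤ ζ.re → ‖ζ‖ < r →
      ‖quasiCompactSymbol α ζ‖ ≤ C * ‖ζ‖ ^ (α + 4) := by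
  have e (c : ℂ) := (cexp_mul_sub_sum_isBigO c (n := 4) (by norm_num)).mono
    (nhdsWithin_le_nhds (s := {0}ᶜ))
  have hP : (fun ζ : ℂ => (1 + coeffB α * (Complex.exp ζ - 2 + Complex.exp (-ζ))) -
      (1 + coeffB α * ζ ^ 2)) =O[𝓝[≠] 0] fun ζ : ℂ => ζ ^ 4 := by
    refine (((e 1).add (e (-1))).const_mul_left (coeffB α : ℂ)).congr_left fun ζ => ?_
    simp only [Finset.sum_range_succ, Finset.sum_range_zero, Nat.factorial, one_mul, neg_mul]
    push_cast
    ring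
  -- The factor `e^{-αζ/2}` is absorbed into the shifts. The weights `μ` sum to 1 and annihilate the
  -- terms in `ζ` and `ζ³`.
  have hB : (fun ζ : ℂ => (coeffMuOne α * Complex.exp ((1 - α / 2) * ζ) +
      coeffMuZero α * Complex.exp ((-α / 2) * ζ) +
      coeffMuNegOne α * Complex.exp ((-1 - α / 2) * ζ)) - (1 + (4 - α ^ 2) / 24 * ζ ^ 2))
      =O[𝓝[≠] 0] fun ζ : ℂ => ζ ^ 4 := by
    refine ((((e (1 - α / 2)).const_mul_left (coeffMuOne α : ℂ)).add
      ((e (-α / 2)).const_mul_left (coeffMuZero α : ℂ))).add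
      ((e (-1 - α / 2)).const_mul_left (coeffMuNegOne α : ℂ))).congr_left fun ζ => ?_
    simp only [Finset.sum_range_succ, Finset.sum_range_zero, Nat.factorial, coeffMuOne,
      coeffMuZero, coeffMuNegOne]
    push_cast
    ring
  have hA := sinhc_power_isBigO (α : ℂ)
  have hA1 : (fun ζ : ℂ => Complex.exp (α * Complex.log (1 + sinhcDeviation ζ)))
      =O[𝓝[≠] 0] fun _ : ℂ => (1 : ℂ) := by
    have h1 : (fun ζ : ℂ => ζ ^ 4) =O[𝓝[≠] 0] fun _ : ℂ => (1 : ℂ) :=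
      ((show Continuous (fun ζ : ℂ => ζ ^ 4) by fun_prop).continuousAt.isBigO_one ℂ).mono
        nhdsWithin_le_nhds
    have h2 : (fun ζ : ℂ => 1 + (α : ℂ) / 24 * ζ ^ 2) =O[𝓝[≠] 0] fun _ : ℂ => (1 : ℂ) :=
      ((show Continuous (fun ζ : ℂ => 1 + (α : ℂ) / 24 * ζ ^ 2) by
        fun_prop).continuousAt.isBigO_one ℂ).mono nhdsWithin_le_nhds
    simpa using (hA.trans h1).add h2
  have hp : (fun ζ : ℂ => 1 + (4 - (α : ℂ) ^ 2) / 24 * ζ ^ 2) =O[𝓝[≠] 0] fun _ : ℂ => (1 : ℂ) :=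
    ((show Continuous (fun ζ : ℂ => 1 + (4 - (α : ℂ) ^ 2) / 24 * ζ ^ 2) by
      fun_prop).continuousAt.isBigO_one ℂ).mono nhdsWithin_le_nhds
  have h4 : (fun ζ : ℂ => (4 - (α : ℂ) ^ 2) / 24 * (α / 24) * ζ ^ 4)
      =O[𝓝[≠] 0] fun ζ : ℂ => ζ ^ 4 :=
    (isBigO_refl _ _).const_mul_left _
  -- With `p`, `a` the quadratic approximations of `B`, `A`, this is `BA - pa = (B - p) A + p (A -
  -- a)`; `h4` accounts for the quartic term of `pa`.
  have hBA := ((hB.mul hA1).congr_right (g₂ := fun ζ : ℂ => ζ ^ 4) fun ζ => mul_one _).add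
    (((hp.mul hA).congr_right (g₂ := fun ζ : ℂ => ζ ^ 4) fun ζ => one_mul _).add h4)
  have hG := hP.sub hBA
  obtain ⟨C, hC⟩ := hG.bound
  obtain ⟨r, hr, hball⟩ := Metric.mem_nhdsWithin_iff.1
    (hC.and (one_sub_cexp_neg_cpow (α : ℂ)))
  refine ⟨r, hr, C, fun ζ hre hζr => ?_⟩
  -- The asymptotics hold on a punctured neighbourhood; at the origin both sides vanish.
  by_cases hζ : ζ = 0
  · subst hζ
    have : (α : ℂ) ≠ 0 := by exact_mod_cast hα.ne'
    simp [quasiCompactSymbol, Complex.zero_cpow this,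
      Real.zero_rpow (show α + 4 ≠ 0 by linarith)]
  obtain ⟨h1, h2⟩ := hball ⟨by simpa using hζr, hζ⟩
  have h2' := h2 hre
  have hfac : quasiCompactSymbol α ζ = ζ ^ (α : ℂ) *
      ((1 + coeffB α * (Complex.exp ζ - 2 + Complex.exp (-ζ))) -
      (coeffMuOne α * Complex.exp ((1 - α / 2) * ζ) +
      coeffMuZero α * Complex.exp ((-α / 2) * ζ) +
      coeffMuNegOne α * Complex.exp ((-1 - α / 2) * ζ)) *
        Complex.exp (α * Complex.log (1 + sinhcDeviation ζ))) := by
    rw [quasiCompactSymbol, h2', show (1 - (α : ℂ) / 2) * ζ = ζ + -α / 2 * ζ by ring,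
      show (-1 - (α : ℂ) / 2) * ζ = -ζ + -α / 2 * ζ by ring, Complex.exp_add, Complex.exp_add]
    ring
  rw [hfac, norm_mul, Complex.norm_cpow_real, Real.rpow_add (norm_pos_iff.2 hζ)]
  rw [norm_pow] at h1
  have h3 : ‖ζ‖ ^ (4 : ℝ) = ‖ζ‖ ^ 4 := by exact_mod_cast Real.rpow_natCast ‖ζ‖ 4
  rw [h3, mul_left_comm]
  refine mul_le_mul_of_nonneg_left ?_ (Real.rpow_nonneg (norm_nonneg _) _)
  refine le_of_eq_of_le ?_ h1
  congr 1
  simp only [coeffB]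
  push_cast
  ring

/-- Away from the origin only size matters. In the strip the exponentials are bounded, so the symbol
is at most `K1 |ζ|^α + K2`, and `|ζ| ≥ r` lets both terms be absorbed into `|ζ|^{α+4}`. -/
theorem quasiCompactSymbol_bound {α : ℝ} (hα : 0 < α) (lam : ℝ) :
    ∃ C : ℝ, ∀ ζ : ℂ, 0 ≤ ζ.re → ζ.re ≤ lam →
      ‖quasiCompactSymbol α ζ‖ ≤ C * ‖ζ‖ ^ (α + 4) := by
  obtain ⟨r, hr, C, hC⟩ := quasiCompactSymbol_near_zero α hα
  set K1 : ℝ := 1 + |coeffB α| * (Real.exp lam + 2 + 1) with hK1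
  set K2 : ℝ := (|coeffMuOne α| * Real.exp lam + |coeffMuZero α| + |coeffMuNegOne α|) * 2 ^ α
    with hK2
  refine ⟨max C (K1 * (r ^ 4)⁻¹ + K2 * (r ^ (α + 4))⁻¹), fun ζ hre hre2 => ?_⟩
  by_cases hζ : ‖ζ‖ < r
  · refine (hC ζ hre hζ).trans ?_
    exact mul_le_mul_of_nonneg_right (le_max_left _ _) (Real.rpow_nonneg (norm_nonneg _) _)
  push Not at hζ
  have hpos : 0 < ‖ζ‖ := hr.trans_le hζ
  have he1 : ‖Complex.exp ζ‖ ≤ Real.exp lam := by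
    rw [Complex.norm_exp]; exact Real.exp_le_exp.2 hre2
  have he2 : ‖Complex.exp (-ζ)‖ ≤ 1 := by
    rw [Complex.norm_exp]; exact Real.exp_le_one_iff.2 (by simpa using hre)
  have h1 : ‖1 + (coeffB α : ℂ) * (Complex.exp ζ - 2 + Complex.exp (-ζ))‖ ≤ K1 := by
    refine (norm_add_le _ _).trans ?_
    rw [norm_one, norm_mul, Complex.norm_real, Real.norm_eq_abs, hK1]
    gcongr
    refine (norm_add_le _ _).trans (add_le_add ((norm_sub_le _ _).trans ?_) he2)
    simpa using he1
  have h2 : ‖(coeffMuOne α : ℂ) * Complex.exp ζ + coeffMuZero α +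
      coeffMuNegOne α * Complex.exp (-ζ)‖ ≤
      |coeffMuOne α| * Real.exp lam + |coeffMuZero α| + |coeffMuNegOne α| := by
    refine (norm_add₃_le).trans ?_
    simp only [norm_mul, Complex.norm_real, Real.norm_eq_abs]
    gcongr
    exact mul_le_of_le_one_right (abs_nonneg _) he2
  have h3 : ‖(1 - Complex.exp (-ζ)) ^ (α : ℂ)‖ ≤ 2 ^ α := by
    rw [Complex.norm_cpow_real]
    refine Real.rpow_le_rpow (norm_nonneg _) ((norm_sub_le _ _).trans ?_) hα.le
    rw [norm_one]; linarith
  have h4 : ‖ζ‖ ^ α ≤ (r ^ 4)⁻¹ * ‖ζ‖ ^ (α + 4) := by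
    have h : ‖ζ‖ ^ (4 : ℝ) = ‖ζ‖ ^ 4 := by exact_mod_cast Real.rpow_natCast ‖ζ‖ 4
    rw [Real.rpow_add hpos, h, inv_mul_eq_div, le_div_iff₀ (by positivity)]
    gcongr
  have h5 : 1 ≤ (r ^ (α + 4))⁻¹ * ‖ζ‖ ^ (α + 4) := by
    rw [inv_mul_eq_div, one_le_div (by positivity)]
    exact Real.rpow_le_rpow hr.le hζ (by linarith)
  have hK1' : 0 ≤ K1 := by positivity
  have hK2' : 0 ≤ K2 := by positivity
  calc ‖quasiCompactSymbol α ζ‖ ≤ ‖ζ‖ ^ α * K1 + K2 := by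
        unfold quasiCompactSymbol
        refine (norm_sub_le _ _).trans (add_le_add ?_ ?_)
        · rw [norm_mul, Complex.norm_cpow_real]
          gcongr
        · rw [norm_mul, hK2]
          gcongr
    _ ≤ ((r ^ 4)⁻¹ * ‖ζ‖ ^ (α + 4)) * K1 + K2 * ((r ^ (α + 4))⁻¹ * ‖ζ‖ ^ (α + 4)) := by
        gcongr
        exact le_mul_of_one_le_right hK2' h5
    _ = (K1 * (r ^ 4)⁻¹ + K2 * (r ^ (α + 4))⁻¹) * ‖ζ‖ ^ (α + 4) := by ring
    _ ≤ _ := mul_le_mul_of_nonneg_right (le_max_right _ _) (by positivity)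

end

/-! ### Fourier decay and weighted integrability on the Bromwich line. -/

noncomputable section

open FourierTransform in
/-- The Fourier transform of a real-valued function. -/
def realFourier (u : ℝ → ℝ) : ℝ → ℂ := 𝓕 (fun x => (u x : ℂ))

/-- The point `lam + 2 π i ω` of the Bromwich line. -/
def bromwich (lam ω : ℝ) : ℂ := lam + 2 * Real.pi * ω * Complex.I

theorem bromwich_re (lam ω : ℝ) : (bromwich lam ω).re = lam := by
  simp [bromwich]

theorem bromwich_im (lam ω : ℝ) : (bromwich lam ω).im = 2 * Real.pi * ω := by
  simp [bromwich]

theorem continuous_bromwich (lam : ℝ) : Continuous (bromwich lam) := by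
  unfold bromwich; fun_prop

theorem abs_le_norm_bromwich (lam ω : ℝ) : |2 * Real.pi * ω| ≤ ‖bromwich lam ω‖ := by
  rw [← bromwich_im lam ω]; exact Complex.abs_im_le_norm _

theorem norm_bromwich_le {lam : ℝ} (hlam : 0 ≤ lam) (ω : ℝ) :
    ‖bromwich lam ω‖ ≤ (lam + 2 * Real.pi) * (1 + |ω|) := by
  refine (norm_add_le _ _).trans ?_
  have hpi := Real.pi_pos
  simp only [norm_mul, Complex.norm_real, Complex.norm_I, Complex.norm_ofNat, Real.norm_eq_abs,
    abs_of_nonneg hlam, abs_of_nonneg hpi.le]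
  nlinarith [abs_nonneg ω, mul_nonneg hlam (abs_nonneg ω)]

theorem bromwich_ne_zero (lam : ℝ) {ω : ℝ} (hω : ω ≠ 0) : bromwich lam ω ≠ 0 := by
  intro h
  have := bromwich_im lam ω
  rw [h] at this
  have hpi := Real.pi_pos.ne'
  simp_all

theorem iteratedDeriv_ofReal_comp {u : ℝ → ℝ} {n : ℕ} (hu : ContDiff ℝ n u) {k : ℕ} (hk : k ≤ n) :
    iteratedDeriv k (fun x => (u x : ℂ)) = fun x => ((iteratedDeriv k u x : ℝ) : ℂ) := by
  induction k with
  | zero => simp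
  | succ k ih =>
    rw [iteratedDeriv_succ, ih (by omega)]
    ext x
    have hd : DifferentiableAt ℝ (iteratedDeriv k u) x :=
      (hu.differentiable_iteratedDeriv k (by exact_mod_cast (show k < n by omega))) x
    rw [iteratedDeriv_succ]
    exact hd.hasDerivAt.ofReal_comp.deriv

open FourierTransform in
theorem norm_fourier_le_integral_norm (f : ℝ → ℂ) (ω : ℝ) : ‖𝓕 f ω‖ ≤ ∫ x, ‖f x‖ :=
  VectorFourier.norm_fourierIntegral_le_integral_norm _ _ _ _ _

theorem continuous_realFourier {u : ℝ → ℝ} (hu : Integrable u) : Continuous (realFourier u) :=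
  VectorFourier.fourierIntegral_continuous Real.continuous_fourierChar
    (by exact continuous_inner) hu.ofReal

/-- Polynomial decay of the Fourier transform of a smooth function with integrable derivatives. -/
theorem norm_realFourier_le {u : ℝ → ℝ} {n : ℕ} (hu : ContDiff ℝ n u)
    (hL1 : ∀ k : ℕ, k ≤ n → Integrable (iteratedDeriv k u)) :
    ∃ C : ℝ, 0 ≤ C ∧ ∀ ω, ‖realFourier u ω‖ ≤ C * (1 + |ω|) ^ (-(n : ℝ)) := by
  have hU : ContDiff ℝ ((n : ℕ∞) : WithTop ℕ∞) (fun x => (u x : ℂ)) :=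
    Complex.ofRealCLM.contDiff.comp hu
  have hUint : ∀ k : ℕ, (k : ℕ∞) ≤ n → Integrable (iteratedDeriv k fun x => (u x : ℂ)) := by
    intro k hk
    have hk' : k ≤ n := by exact_mod_cast hk
    rw [iteratedDeriv_ofReal_comp hu hk']
    exact (hL1 k hk').ofReal
  set A := ∫ x, ‖(u x : ℂ)‖ with hA
  set B := ∫ x, ‖iteratedDeriv n (fun x => (u x : ℂ)) x‖ with hB
  have hA0 : 0 ≤ A := integral_nonneg fun _ => norm_nonneg _
  have hB0 : 0 ≤ B := integral_nonneg fun _ => norm_nonneg _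
  refine ⟨2 ^ n * (A + B), by positivity, fun ω => ?_⟩
  have h1 : ‖realFourier u ω‖ ≤ A := norm_fourier_le_integral_norm _ _
  have h2 : |ω| ^ n * ‖realFourier u ω‖ ≤ B := by
    have h := norm_fourier_le_integral_norm (iteratedDeriv n fun x => (u x : ℂ)) ω
    rw [Real.fourier_iteratedDeriv hU hUint le_rfl] at h
    simp only [norm_smul, norm_pow, norm_mul, Complex.norm_real, Complex.norm_I,
      Complex.norm_ofNat, Real.norm_eq_abs, mul_one] at h
    refine le_trans ?_ h
    refine mul_le_mul_of_nonneg_right ?_ (norm_nonneg _)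
    refine pow_le_pow_left₀ (abs_nonneg _) ?_ _
    have : 1 ≤ 2 * |Real.pi| := by
      rw [abs_of_pos Real.pi_pos]; linarith [Real.pi_gt_three]
    exact le_mul_of_one_le_left (abs_nonneg _) this
  have hpos : 0 < 1 + |ω| := by positivity
  rw [Real.rpow_neg hpos.le, Real.rpow_natCast, ← div_eq_mul_inv, le_div_iff₀ (by positivity)]
  -- Whichever of `1` and `|ω|` is larger, `1 + |ω|` is at most twice it.
  have h3 : (1 + |ω|) ^ n ≤ 2 ^ n * (1 + |ω| ^ n) := by
    have h0 := abs_nonneg ω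
    rcases le_total |ω| 1 with h | h
    · calc (1 + |ω|) ^ n ≤ 2 ^ n := pow_le_pow_left₀ hpos.le (by linarith) _
        _ ≤ _ := le_mul_of_one_le_right (by positivity) (by linarith [pow_nonneg h0 n])
    · calc (1 + |ω|) ^ n ≤ (2 * |ω|) ^ n := pow_le_pow_left₀ hpos.le (by linarith) _
        _ = 2 ^ n * |ω| ^ n := mul_pow _ _ _
        _ ≤ _ := by gcongr; linarith
  calc ‖realFourier u ω‖ * (1 + |ω|) ^ n ≤ ‖realFourier u ω‖ * (2 ^ n * (1 + |ω| ^ n)) := by gcongr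
    _ = 2 ^ n * (‖realFourier u ω‖ + |ω| ^ n * ‖realFourier u ω‖) := by ring
    _ ≤ _ := by gcongr

theorem integrable_one_add_abs_rpow {r : ℝ} (hr : r < -1) :
    Integrable (fun ω : ℝ => (1 + |ω|) ^ r) := by
  simpa using integrable_one_add_norm (E := ℝ) (μ := volume) (r := -r) (by simp; linarith)

theorem integrableOn_abs_rpow {s : ℝ} (hs : -1 < s) :
    IntegrableOn (fun ω : ℝ => |ω| ^ s) (Set.Icc (-1) 1) := by
  have h1 : IntervalIntegrable (fun ω : ℝ => |ω| ^ s) volume 0 1 := by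
    refine (intervalIntegral.intervalIntegrable_rpow' (a := 0) (b := 1) hs).congr ?_
    intro x hx
    rw [Set.uIoc_of_le zero_le_one] at hx
    simp [abs_of_pos hx.1]
  have h2 : IntervalIntegrable (fun ω : ℝ => |ω| ^ s) volume 0 (-1) := by
    rw [IntervalIntegrable.iff_comp_neg]
    simpa using h1
  exact (intervalIntegrable_iff_integrableOn_Icc_of_le (by norm_num)).1 (h2.symm.trans h1)

/-- Near `0` the transform is bounded and `|ω|^s` is integrable since `s > -1`; far away the decay
suffices. The exponent needed later is `s = α - 2`. -/
theorem integrable_abs_rpow_mul_realFourier {u : ℝ → ℝ} (hui : Integrable u) {C s : ℝ} {n : ℕ}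
    (hn : 2 ≤ n) (hC : ∀ ω, ‖realFourier u ω‖ ≤ C * (1 + |ω|) ^ (-(n : ℝ)))
    (hs : -1 < s) (hs0 : s ≤ 0) :
    Integrable (fun ω : ℝ => |2 * Real.pi * ω| ^ s * ‖realFourier u ω‖) := by
  have hn' : (2 : ℝ) ≤ n := by exact_mod_cast hn
  have hC0 : 0 ≤ C := by
    have := (norm_nonneg _).trans (hC 0); simpa using this
  have hmeas : Measurable (fun ω : ℝ => |ω| ^ s * ‖realFourier u ω‖) := by
    have := (continuous_realFourier hui).measurable
    fun_prop
  have key : Integrable (fun ω : ℝ => |ω| ^ s * ‖realFourier u ω‖) := by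
    rw [← integrableOn_univ, ← Set.union_compl_self (Set.Icc (-1 : ℝ) 1)]
    refine IntegrableOn.union ?_ ?_
    · refine ((integrableOn_abs_rpow hs).mul_const C).mono' hmeas.aestronglyMeasurable
        (Filter.Eventually.of_forall fun ω => ?_)
      have h0 : 0 ≤ |ω| ^ s := Real.rpow_nonneg (abs_nonneg _) _
      rw [Real.norm_of_nonneg (by positivity)]
      refine mul_le_mul_of_nonneg_left ((hC ω).trans ?_) h0
      refine mul_le_of_le_one_right hC0 ?_
      exact Real.rpow_le_one_of_one_le_of_nonpos (by linarith [abs_nonneg ω]) (by linarith)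
    · refine (((integrable_one_add_abs_rpow (r := -n) (by linarith)).const_mul
        C).integrableOn).mono' hmeas.aestronglyMeasurable
        ((ae_restrict_iff' measurableSet_Icc.compl).2 (Filter.Eventually.of_forall fun ω hω => ?_))
      have h1 : 1 ≤ |ω| := by
        by_contra h
        exact hω (abs_le.1 (le_of_lt (not_le.1 h)))
      have h0 : 0 ≤ |ω| ^ s := Real.rpow_nonneg (abs_nonneg _) _
      rw [Real.norm_of_nonneg (by positivity)]
      calc |ω| ^ s * ‖realFourier u ω‖ ≤ 1 * ‖realFourier u ω‖ := by
            gcongr; exact Real.rpow_le_one_of_one_le_of_nonpos h1 hs0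
        _ ≤ _ := by rw [one_mul]; exact hC ω
  refine (key.const_mul ((2 * Real.pi) ^ s)).congr (Filter.Eventually.of_forall fun ω => ?_)
  have hpi : 0 ≤ 2 * Real.pi := by positivity
  simp only
  rw [abs_mul, abs_of_nonneg hpi, Real.mul_rpow hpi (abs_nonneg _), mul_assoc]

theorem integrable_norm_bromwich_rpow_mul_realFourier {u : ℝ → ℝ} (hui : Integrable u)
    {C s lam : ℝ} {n : ℕ} (hlam : 0 ≤ lam)
    (hC : ∀ ω, ‖realFourier u ω‖ ≤ C * (1 + |ω|) ^ (-(n : ℝ)))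
    (hs0 : 0 ≤ s) (hs : s + 1 < n) :
    Integrable (fun ω : ℝ => ‖bromwich lam ω‖ ^ s * ‖realFourier u ω‖) := by
  have hmeas : Measurable (fun ω : ℝ => ‖bromwich lam ω‖ ^ s * ‖realFourier u ω‖) := by
    have := (continuous_realFourier hui).measurable
    have := (continuous_bromwich lam).measurable
    fun_prop
  refine ((integrable_one_add_abs_rpow (r := s - n) (by linarith)).const_mul
    ((lam + 2 * Real.pi) ^ s * C)).mono' hmeas.aestronglyMeasurable
    (Filter.Eventually.of_forall fun ω => ?_)
  have hpos : 0 < 1 + |ω| := by positivity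
  rw [Real.norm_of_nonneg (by positivity)]
  calc ‖bromwich lam ω‖ ^ s * ‖realFourier u ω‖
      ≤ ((lam + 2 * Real.pi) * (1 + |ω|)) ^ s * (C * (1 + |ω|) ^ (-(n : ℝ))) := by
        gcongr
        · exact norm_bromwich_le hlam ω
        · exact hC ω
    _ = _ := by
        rw [Real.mul_rpow (by positivity) hpos.le, sub_eq_add_neg, Real.rpow_add hpos]
        ring

open FourierTransform in
theorem eq_integral_realFourier {u : ℝ → ℝ} (huc : Continuous u) (hui : Integrable u)
    (hF : Integrable (realFourier u)) (x : ℝ) :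
    (u x : ℂ) = ∫ ω, realFourier u ω * Complex.exp (bromwich 0 ω * x) := by
  have hcont : Continuous (fun x => (u x : ℂ)) := by fun_prop
  have h := congrFun (hcont.fourierInv_fourier_eq hui.ofReal hF) x
  rw [Real.fourierInv_eq'] at h
  rw [← h]
  congr 1
  ext ω
  rw [smul_eq_mul, mul_comm, realFourier, bromwich]
  congr 2
  simp
  ring

end

/-! ### The tempered Riemann-Liouville derivative as a multiplier. -/

noncomputable section

theorem bromwich_add_real (lam ω : ℝ) : bromwich lam ω = lam + bromwich 0 ω := by
  simp [bromwich]

theorem norm_cexp_bromwich_mul (lam ω x : ℝ) :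
    ‖Complex.exp (bromwich lam ω * x)‖ = Real.exp (lam * x) := by
  rw [Complex.norm_exp, Complex.re_mul_ofReal, bromwich_re]

theorem abs_le_integral_norm_realFourier {u : ℝ → ℝ} (huc : Continuous u) (hui : Integrable u)
    (hF : Integrable (realFourier u)) (x : ℝ) : |u x| ≤ ∫ ω, ‖realFourier u ω‖ := by
  rw [← Real.norm_eq_abs, ← Complex.norm_real, eq_integral_realFourier huc hui hF x]
  refine (norm_integral_le_integral_norm _).trans (le_of_eq ?_)
  congr 1
  ext ω
  rw [norm_mul, norm_cexp_bromwich_mul]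
  simp

/-- Boundedness of `u` handles the singularity at `t = 0`, integrability of `u` the tail where
`t^{s-1} ≤ 1`. No exponential decay is used, so untempered kernels are covered. -/
theorem integrableOn_rpow_mul_comp_sub_left {u : ℝ → ℝ} (huc : Continuous u) (hui : Integrable u)
    {M : ℝ} (hM : ∀ x, |u x| ≤ M) {s : ℝ} (hs0 : 0 < s) (hs1 : s ≤ 1) (x : ℝ) :
    IntegrableOn (fun t => t ^ (s - 1) * u (x - t)) (Set.Ioi 0) := by
  have hmeas : Measurable (fun t => t ^ (s - 1) * u (x - t)) := by
    have := huc.measurable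
    fun_prop
  rw [← Set.Ioc_union_Ioi_eq_Ioi (zero_le_one (α := ℝ))]
  refine IntegrableOn.union ?_ ?_
  · have h1 := (intervalIntegrable_iff_integrableOn_Ioc_of_le (zero_le_one (α := ℝ))).1
      (intervalIntegral.intervalIntegrable_rpow' (a := 0) (b := 1) (r := s - 1) (by linarith))
    refine (h1.mul_const M).mono' hmeas.aestronglyMeasurable
      ((ae_restrict_iff' measurableSet_Ioc).2 (Filter.Eventually.of_forall fun t ht => ?_))
    have h0 := Real.rpow_nonneg ht.1.le (s - 1)
    rw [norm_mul, Real.norm_of_nonneg h0]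
    exact mul_le_mul_of_nonneg_left (hM _) h0
  · refine (hui.comp_sub_left x).norm.integrableOn.mono' hmeas.aestronglyMeasurable
      ((ae_restrict_iff' measurableSet_Ioi).2 (Filter.Eventually.of_forall fun t ht => ?_))
    have ht' : (1 : ℝ) < t := ht
    rw [norm_mul, Real.norm_of_nonneg (Real.rpow_nonneg (by linarith) _)]
    exact mul_le_of_le_one_left (norm_nonneg _)
      (Real.rpow_le_one_of_one_le_of_nonpos ht'.le (by linarith))

/-- The bound is independent of `lam`, so it dominates a whole family of tempering parameters at
once. -/
theorem norm_bromwich_cpow_neg_le (lam : ℝ) {s : ℝ} (hs : 0 ≤ s) {ω : ℝ} (hω : ω ≠ 0) :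
    ‖bromwich lam ω ^ (-(s : ℂ))‖ ≤ |2 * Real.pi * ω| ^ (-s) := by
  rw [← Complex.ofReal_neg, Complex.norm_cpow_real]
  have hpi := Real.pi_pos.ne'
  exact Real.rpow_le_rpow_of_nonpos (by positivity) (abs_le_norm_bromwich lam ω) (by linarith)

theorem ae_ne_zero_real : ∀ᵐ ω : ℝ, ω ≠ 0 := by
  simp [ae_iff]

theorem measurable_bromwich_cpow (lam : ℝ) (c : ℂ) :
    Measurable (fun ω => bromwich lam ω ^ c) := by
  have := (continuous_bromwich lam).measurable
  fun_prop

/-- Tempered fractional integration as a Fourier multiplier, for positive tempering. -/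
theorem tempered_integral_eq_of_pos {u : ℝ → ℝ} (huc : Continuous u) (hui : Integrable u)
    (hF : Integrable (realFourier u)) {s : ℝ} (hs0 : 0 < s) {mu : ℝ} (hmu : 0 < mu) (x : ℝ) :
    ∫ t in Set.Ioi (0 : ℝ), ((t ^ (s - 1) * Real.exp (-mu * t) * u (x - t) : ℝ) : ℂ) =
      Real.Gamma s * ∫ ω, bromwich mu ω ^ (-(s : ℂ)) * realFourier u ω *
        Complex.exp (bromwich 0 ω * x) := by
  -- Positive tempering makes the kernel integrable; with `û ∈ L¹` this justifies Fubini.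
  have hk : IntegrableOn (fun t : ℝ => t ^ (s - 1) * Real.exp (-mu * t)) (Set.Ioi 0) := by
    simpa using integrableOn_rpow_mul_exp_neg_mul_rpow (s := s - 1) (p := 1) (by linarith)
      zero_lt_one hmu
  have hprod : Integrable (Function.uncurry fun t ω : ℝ =>
      ((t ^ (s - 1) * Real.exp (-mu * t) : ℝ) : ℂ) *
        (realFourier u ω * Complex.exp (bromwich 0 ω * ((x - t : ℝ) : ℂ))))
      ((volume.restrict (Set.Ioi 0)).prod volume) := by
    have h := (Integrable.mul_prod hk.ofReal hF : Integrable (fun p : ℝ × ℝ =>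
      ((p.1 ^ (s - 1) * Real.exp (-mu * p.1) : ℝ) : ℂ) * realFourier u p.2)
      ((volume.restrict (Set.Ioi 0)).prod volume))
    have hb := (continuous_bromwich 0).measurable
    have hFm := (continuous_realFourier hui).measurable
    refine h.mono (by
      refine Measurable.aestronglyMeasurable ?_
      unfold Function.uncurry
      fun_prop) (Filter.Eventually.of_forall fun p => ?_)
    simp only [Function.uncurry, norm_mul, norm_cexp_bromwich_mul, zero_mul, Real.exp_zero, mul_one]
    exact le_rfl
  calc ∫ t in Set.Ioi (0 : ℝ), ((t ^ (s - 1) * Real.exp (-mu * t) * u (x - t) : ℝ) : ℂ)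
      = ∫ t in Set.Ioi (0 : ℝ), ∫ ω, ((t ^ (s - 1) * Real.exp (-mu * t) : ℝ) : ℂ) *
        (realFourier u ω * Complex.exp (bromwich 0 ω * ((x - t : ℝ) : ℂ))) := by
        congr 1
        ext t
        rw [integral_const_mul, ← eq_integral_realFourier huc hui hF, Complex.ofReal_mul]
    _ = ∫ ω, ∫ t in Set.Ioi (0 : ℝ), ((t ^ (s - 1) * Real.exp (-mu * t) : ℝ) : ℂ) *
        (realFourier u ω * Complex.exp (bromwich 0 ω * ((x - t : ℝ) : ℂ))) :=
        integral_integral_swap hprod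
    _ = ∫ ω, Real.Gamma s * (bromwich mu ω ^ (-(s : ℂ)) * realFourier u ω *
        Complex.exp (bromwich 0 ω * x)) := by
        congr 1
        ext ω
        have hl := integral_rpow_mul_cexp_neg_mul_Ioi hs0 (r := bromwich mu ω)
          (by rwa [bromwich_re])
        calc _ = ∫ t in Set.Ioi (0 : ℝ), (((t ^ (s - 1) : ℝ) : ℂ) *
                Complex.exp (-(bromwich mu ω * t))) *
                (realFourier u ω * Complex.exp (bromwich 0 ω * x)) := by
              congr 1
              ext t
              rw [bromwich_add_real mu]
              push_cast
              rw [show -((mu + bromwich 0 ω) * (t : ℂ)) = -mu * t + -(bromwich 0 ω * t) by ring,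
                show bromwich 0 ω * ((x : ℂ) - t) = bromwich 0 ω * x + -(bromwich 0 ω * t) by ring,
                Complex.exp_add, Complex.exp_add]
              ring
          _ = _ := by
              rw [integral_mul_const, hl]
              ring
    _ = _ := integral_const_mul _ _

open Filter Topology in
/-- Tempered fractional integration as a Fourier multiplier. -/
theorem tempered_integral_eq {u : ℝ → ℝ} (huc : Continuous u) (hui : Integrable u)
    (hF : Integrable (realFourier u)) {s : ℝ} (hs0 : 0 < s) (hs1 : s ≤ 1)
    (hFs : Integrable (fun ω : ℝ => |2 * Real.pi * ω| ^ (-s) * ‖realFourier u ω‖))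
    {lam : ℝ} (hlam : 0 ≤ lam) (x : ℝ) :
    ∫ t in Set.Ioi (0 : ℝ), ((t ^ (s - 1) * Real.exp (-lam * t) * u (x - t) : ℝ) : ℂ) =
      Real.Gamma s * ∫ ω, bromwich lam ω ^ (-(s : ℂ)) * realFourier u ω *
        Complex.exp (bromwich 0 ω * x) := by
  -- At `lam = 0` the kernel is not integrable at infinity, so Fubini fails there. Letting `mu`
  -- decrease to `lam` by dominated convergence on both sides covers this case.
  have hl : Tendsto (fun mu : ℝ => ∫ t in Set.Ioi (0 : ℝ),
      ((t ^ (s - 1) * Real.exp (-mu * t) * u (x - t) : ℝ) : ℂ)) (𝓝[>] lam)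
      (𝓝 (∫ t in Set.Ioi (0 : ℝ),
        ((t ^ (s - 1) * Real.exp (-lam * t) * u (x - t) : ℝ) : ℂ))) := by
    refine tendsto_integral_filter_of_dominated_convergence
      (fun t => ‖t ^ (s - 1) * u (x - t)‖) ?_ ?_ ?_ ?_
    · have := huc.measurable
      exact Eventually.of_forall fun mu => Measurable.aestronglyMeasurable (by fun_prop)
    · filter_upwards [self_mem_nhdsWithin] with mu hmu
      refine (ae_restrict_iff' measurableSet_Ioi).2 (Eventually.of_forall fun t ht => ?_)
      have hmu' : lam < mu := hmu
      have ht' : (0 : ℝ) < t := ht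
      rw [Complex.norm_real, norm_mul, norm_mul, norm_mul, Real.norm_of_nonneg (Real.exp_pos _).le]
      refine mul_le_mul_of_nonneg_right (mul_le_of_le_one_right (norm_nonneg _) ?_) (norm_nonneg _)
      exact Real.exp_le_one_iff.2 (by nlinarith)
    · exact (integrableOn_rpow_mul_comp_sub_left huc hui
        (abs_le_integral_norm_realFourier huc hui hF) hs0 hs1 x).norm
    · refine Eventually.of_forall fun t => ?_
      have : Continuous (fun mu : ℝ => ((t ^ (s - 1) * Real.exp (-mu * t) * u (x - t) : ℝ) : ℂ)) := by
        fun_prop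
      exact (this.tendsto lam).mono_left nhdsWithin_le_nhds
  have hr : Tendsto (fun mu : ℝ => ∫ ω, bromwich mu ω ^ (-(s : ℂ)) * realFourier u ω *
        Complex.exp (bromwich 0 ω * x)) (𝓝[>] lam)
      (𝓝 (∫ ω, bromwich lam ω ^ (-(s : ℂ)) * realFourier u ω *
        Complex.exp (bromwich 0 ω * x))) := by
    refine tendsto_integral_filter_of_dominated_convergence _ ?_ ?_ hFs ?_
    · have hb := (continuous_bromwich 0).measurable
      have hFm := (continuous_realFourier hui).measurable
      exact Eventually.of_forall fun mu => Measurable.aestronglyMeasurable (by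
        have := measurable_bromwich_cpow mu (-(s : ℂ))
        fun_prop)
    · refine Eventually.of_forall fun mu => ?_
      filter_upwards [ae_ne_zero_real] with ω hω
      rw [norm_mul, norm_mul, norm_cexp_bromwich_mul, zero_mul, Real.exp_zero, mul_one]
      exact mul_le_mul_of_nonneg_right (norm_bromwich_cpow_neg_le mu hs0.le hω) (norm_nonneg _)
    · filter_upwards [ae_ne_zero_real] with ω hω
      refine Tendsto.mul_const _ (Tendsto.mul_const _ ?_)
      -- For `ω ≠ 0` the point is off the real axis, hence off the branch cut.
      have h1 : ContinuousAt (fun z : ℂ => z ^ (-(s : ℂ))) (bromwich lam ω) := by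
        refine continuousAt_cpow_const (Or.inr ?_)
        rw [bromwich_im]
        have := Real.pi_pos.ne'
        positivity
      have h2 : Continuous (fun mu => bromwich mu ω) := by unfold bromwich; fun_prop
      exact h1.tendsto.comp ((h2.tendsto lam).mono_left nhdsWithin_le_nhds)
  refine tendsto_nhds_unique hl ((hr.const_mul (Real.Gamma s : ℂ)).congr' ?_)
  filter_upwards [self_mem_nhdsWithin] with mu hmu
  exact (tempered_integral_eq_of_pos huc hui hF hs0 (hlam.trans_lt hmu) x).symm

theorem hasDerivAt_integral_mul_cexp_bromwich {lam : ℝ} (hlam : 0 ≤ lam) {G G' : ℝ → ℂ}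
    (hG : Integrable G) (hG' : Integrable G') (h : ∀ᵐ ω, G' ω = bromwich lam ω * G ω) (x : ℝ) :
    HasDerivAt (fun x : ℝ => ∫ ω, G ω * Complex.exp (bromwich lam ω * x))
      (∫ ω, G' ω * Complex.exp (bromwich lam ω * x)) x := by
  have hexp : ∀ x : ℝ, Continuous (fun ω => Complex.exp (bromwich lam ω * x)) := by
    intro x
    have := continuous_bromwich lam
    fun_prop
  have hint : ∀ (x : ℝ) {G : ℝ → ℂ}, Integrable G →
      Integrable (fun ω => G ω * Complex.exp (bromwich lam ω * x)) := by
    intro x G hG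
    refine hG.mul_bdd (c := Real.exp (lam * x)) (hexp x).aestronglyMeasurable
      (Filter.Eventually.of_forall fun ω => ?_)
    rw [norm_cexp_bromwich_mul]
  refine (hasDerivAt_integral_of_dominated_loc_of_deriv_le
    (bound := fun ω => ‖G' ω‖ * Real.exp (lam * (x + 1)))
    (F' := fun x ω => G' ω * Complex.exp (bromwich lam ω * x))
    (Metric.ball_mem_nhds x one_pos) ?_ (hint x hG) (hint x hG').aestronglyMeasurable ?_
    (hG'.norm.mul_const _) ?_).2
  · exact Filter.Eventually.of_forall fun y => (hint y hG).aestronglyMeasurable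
  · refine Filter.Eventually.of_forall fun ω y hy => ?_
    rw [norm_mul, norm_cexp_bromwich_mul]
    have := (abs_lt.1 (by simpa [Real.dist_eq] using hy : |y - x| < 1)).2
    gcongr
    linarith
  · filter_upwards [h] with ω hω y _
    have h1 : HasDerivAt (fun y : ℝ => bromwich lam ω * (y : ℂ)) (bromwich lam ω) y := by
      simpa using (Complex.ofRealCLM.hasDerivAt (x := y)).const_mul (bromwich lam ω)
    convert! h1.cexp.const_mul (G ω) using 1
    rw [hω]
    ring

theorem rlOrder_eq_two {α : ℝ} (hα1 : 1 < α) (hα2 : α < 2) : rlOrder α = 2 := by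
  have : ⌊α⌋₊ = 1 := by
    rw [Nat.floor_eq_iff (by linarith)]
    constructor
    · push_cast; linarith
    · push_cast; linarith
  simp [rlOrder, this]

theorem rlIntegrand_comp_sub_left {α : ℝ} (hα1 : 1 < α) (hα2 : α < 2) (lam : ℝ) (u : ℝ → ℝ)
    (x t : ℝ) : rlIntegrand α (expMul lam u) x (x - t) =
      Real.exp (lam * x) * (t ^ ((2 - α) - 1) * Real.exp (-lam * t) * u (x - t)) := by
  unfold rlIntegrand expMul
  rw [rlOrder_eq_two hα1 hα2, sub_sub_cancel, show lam * (x - t) = lam * x + -lam * t by ring,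
    Real.exp_add]
  push_cast
  ring

theorem indicator_Iic_comp_sub_left (f : ℝ → ℝ) (x : ℝ) :
    (fun t => (Set.Iic x).indicator f (x - t)) = (Set.Ici 0).indicator fun t => f (x - t) := by
  ext t
  by_cases ht : 0 ≤ t
  · rw [Set.indicator_of_mem (by simpa using ht), Set.indicator_of_mem (by simpa using ht)]
  · rw [Set.indicator_of_notMem (by simpa using ht), Set.indicator_of_notMem (by simpa using ht)]

theorem integrableOn_rlIntegrand {α : ℝ} (hα1 : 1 < α) (hα2 : α < 2) {lam : ℝ} (hlam : 0 ≤ lam)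
    {u : ℝ → ℝ} (huc : Continuous u) (hui : Integrable u) {M : ℝ} (hM : ∀ x, |u x| ≤ M) (x : ℝ) :
    IntegrableOn (rlIntegrand α (expMul lam u) x) (Set.Iic x) := by
  rw [← integrable_indicator_iff measurableSet_Iic, ← integrable_comp_sub_left _ x,
    indicator_Iic_comp_sub_left, integrable_indicator_iff measurableSet_Ici,
    integrableOn_Ici_iff_integrableOn_Ioi]
  simp only [rlIntegrand_comp_sub_left hα1 hα2]
  refine Integrable.const_mul ?_ _
  refine Integrable.mono (integrableOn_rpow_mul_comp_sub_left huc hui hM (s := 2 - α)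
    (by linarith) (by linarith) x) ?_ ?_
  · have := huc.measurable
    exact Measurable.aestronglyMeasurable (by fun_prop)
  · refine (ae_restrict_iff' measurableSet_Ioi).2 (Filter.Eventually.of_forall fun t ht => ?_)
    have ht' : (0 : ℝ) < t := ht
    rw [norm_mul, norm_mul, norm_mul, Real.norm_of_nonneg (Real.exp_pos _).le]
    refine mul_le_mul_of_nonneg_right (mul_le_of_le_one_right (norm_nonneg _) ?_) (norm_nonneg _)
    exact Real.exp_le_one_iff.2 (by nlinarith)

theorem rlIntegral_eq {α : ℝ} (hα1 : 1 < α) (hα2 : α < 2) (lam : ℝ) (u : ℝ → ℝ) (x : ℝ) :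
    rlIntegral α (expMul lam u) x = Real.exp (lam * x) *
      ∫ t in Set.Ioi (0 : ℝ), t ^ ((2 - α) - 1) * Real.exp (-lam * t) * u (x - t) := by
  unfold rlIntegral
  rw [← integral_indicator measurableSet_Iic, ← integral_sub_left_eq_self _ _ x,
    indicator_Iic_comp_sub_left, integral_indicator measurableSet_Ici, integral_Ici_eq_integral_Ioi]
  simp only [rlIntegrand_comp_sub_left hα1 hα2]
  exact integral_const_mul _ _

/-- The Bromwich integral of `z ^ β` against the Fourier transform of `u`. -/
def bromwichIntegral (lam β : ℝ) (u : ℝ → ℝ) (x : ℝ) : ℂ :=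
  ∫ ω, bromwich lam ω ^ (β : ℂ) * realFourier u ω * Complex.exp (bromwich lam ω * x)

theorem rlIntegral_eq_bromwichIntegral {α : ℝ} (hα1 : 1 < α) (hα2 : α < 2) {u : ℝ → ℝ}
    (huc : Continuous u) (hui : Integrable u) (hF : Integrable (realFourier u))
    (hFs : Integrable (fun ω : ℝ => |2 * Real.pi * ω| ^ (α - 2) * ‖realFourier u ω‖))
    {lam : ℝ} (hlam : 0 ≤ lam) (x : ℝ) :
    rlIntegral α (expMul lam u) x =
      Real.Gamma (2 - α) * (bromwichIntegral lam (α - 2) u x).re := by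
  have h := tempered_integral_eq huc hui hF (s := 2 - α) (by linarith) (by linarith)
    (by simpa using hFs) hlam x
  rw [integral_complex_ofReal] at h
  have h2 : ((rlIntegral α (expMul lam u) x : ℝ) : ℂ) =
      Real.Gamma (2 - α) * bromwichIntegral lam (α - 2) u x := by
    rw [rlIntegral_eq hα1 hα2, Complex.ofReal_mul, h, mul_left_comm, ← integral_const_mul,
      bromwichIntegral]
    congr 2
    ext ω
    rw [bromwich_add_real lam, add_mul, Complex.exp_add]
    push_cast
    rw [neg_sub]
    ring
  have h3 := congrArg Complex.re h2
  rwa [Complex.ofReal_re, Complex.re_ofReal_mul] at h3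

/-- Differentiation brings down a factor `z`. Applied twice, it climbs from `α - 2` to `α`.
Excluding `ω = 0` avoids the failure of the power law at `z = 0` when `lam = 0`. -/
theorem hasDerivAt_bromwichIntegral {lam β : ℝ} (hlam : 0 ≤ lam) {u : ℝ → ℝ}
    (h0 : Integrable (fun ω => bromwich lam ω ^ (β : ℂ) * realFourier u ω))
    (h1 : Integrable (fun ω => bromwich lam ω ^ ((β + 1 : ℝ) : ℂ) * realFourier u ω)) (x : ℝ) :
    HasDerivAt (fun x => (bromwichIntegral lam β u x).re)
      (bromwichIntegral lam (β + 1) u x).re x := by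
  have h := hasDerivAt_integral_mul_cexp_bromwich hlam h0 h1 (by
    filter_upwards [ae_ne_zero_real] with ω hω
    rw [Complex.ofReal_add, Complex.ofReal_one, Complex.cpow_add _ _ (bromwich_ne_zero lam hω),
      Complex.cpow_one]
    ring) x
  exact Complex.reCLM.hasFDerivAt.comp_hasDerivAt x h

end

/-! ### The scheme error as a multiplier, and the final bound. -/

noncomputable section

/-- Positive scaling preserves the argument, so no branch correction appears. -/
theorem mul_ofReal_cpow {α h : ℝ} (hα : 0 < α) (hh : 0 < h) (z : ℂ) :
    (z * h) ^ (α : ℂ) = z ^ (α : ℂ) * ((h ^ α : ℝ) : ℂ) := by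
  by_cases hz : z = 0
  · have : (α : ℂ) ≠ 0 := by exact_mod_cast hα.ne'
    simp [hz, Complex.zero_cpow this]
  · have hc : (h : ℂ) ≠ 0 := by exact_mod_cast hh.ne'
    rw [Complex.ofReal_cpow hh.le, Complex.cpow_def_of_ne_zero (mul_ne_zero hz hc),
      Complex.cpow_def_of_ne_zero hz, Complex.cpow_def_of_ne_zero hc,
      Complex.log_mul_ofReal h hh z hz, ← Complex.exp_add, Complex.ofReal_log hh.le]
    congr 1
    ring

theorem integral_scheme_combination {A₀ A₁ A₂ B₀ B₁ B₂ : ℝ → ℂ} (hA₀ : Integrable A₀)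
    (hA₁ : Integrable A₁) (hA₂ : Integrable A₂) (hB₀ : Integrable B₀) (hB₁ : Integrable B₁)
    (hB₂ : Integrable B₂) {b c m₀ m₁ m₂ : ℂ} :
    ∫ ω, (A₁ ω + b * (A₀ ω - 2 * A₁ ω + A₂ ω)) -
      (m₀ * (c * B₀ ω) + m₁ * (c * B₁ ω) + m₂ * (c * B₂ ω)) =
    ((∫ ω, A₁ ω) + b * ((∫ ω, A₀ ω) - 2 * (∫ ω, A₁ ω) + ∫ ω, A₂ ω)) -
      (m₀ * (c * ∫ ω, B₀ ω) + m₁ * (c * ∫ ω, B₁ ω) + m₂ * (c * ∫ ω, B₂ ω)) := by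
  have i1 : Integrable (fun ω => A₀ ω - 2 * A₁ ω) := hA₀.sub (hA₁.const_mul 2)
  have i2 : Integrable (fun ω => A₀ ω - 2 * A₁ ω + A₂ ω) := i1.add hA₂
  have i3 : Integrable (fun ω => A₁ ω + b * (A₀ ω - 2 * A₁ ω + A₂ ω)) := hA₁.add (i2.const_mul b)
  have j0 := (hB₀.const_mul c).const_mul m₀
  have j1 := (hB₁.const_mul c).const_mul m₁
  have j2 := (hB₂.const_mul c).const_mul m₂
  have k1 : Integrable (fun ω => m₀ * (c * B₀ ω) + m₁ * (c * B₁ ω)) := j0.add j1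
  have k2 : Integrable (fun ω => m₀ * (c * B₀ ω) + m₁ * (c * B₁ ω) + m₂ * (c * B₂ ω)) := k1.add j2
  rw [integral_sub i3 k2, integral_add hA₁ (i2.const_mul b), integral_const_mul,
    integral_add i1 hA₂, integral_sub hA₀ (hA₁.const_mul 2), integral_add k1 j2,
    integral_add j0 j1]
  simp only [integral_const_mul]

/-- The standing Fourier-side regularity used for the quasi-compact scheme. -/
structure FourierRegular (α lam : ℝ) (u : ℝ → ℝ) : Prop where
  continuous : Continuous u
  integrable : Integrable u
  integrable_fourier : Integrable (realFourier u)
  integrable_singular : Integrable (fun ω : ℝ => |2 * Real.pi * ω| ^ (α - 2) * ‖realFourier u ω‖)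
  integrable_bromwich : ∀ s : ℝ, 0 ≤ s → s ≤ α + 4 →
    Integrable (fun ω : ℝ => ‖bromwich lam ω‖ ^ s * ‖realFourier u ω‖)

/-- Decay of order 7 is enough because `s ≤ α + 4 < 6` gives `s + 1 < 7`. -/
theorem fourierRegular_of_contDiff {α lam : ℝ} (hα1 : 1 < α) (hα2 : α < 2) (hlam : 0 ≤ lam)
    {u : ℝ → ℝ} (hu : ContDiff ℝ 7 u)
    (hL1 : ∀ k : ℕ, k ≤ 7 → Integrable (iteratedDeriv k u)) : FourierRegular α lam u := by
  have hui : Integrable u := by simpa using hL1 0 (by norm_num)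
  obtain ⟨C, -, hC⟩ := norm_realFourier_le (n := 7) (by exact_mod_cast hu) hL1
  have hmeas := (continuous_realFourier hui).aestronglyMeasurable (μ := volume)
  refine ⟨hu.continuous, hui, ?_, ?_, fun s hs0 hs => ?_⟩
  · rw [← integrable_norm_iff hmeas]
    simpa using integrable_norm_bromwich_rpow_mul_realFourier (s := 0) hui hlam hC le_rfl
      (by norm_num)
  · exact integrable_abs_rpow_mul_realFourier hui (by norm_num) hC (by linarith) (by linarith)
  · exact integrable_norm_bromwich_rpow_mul_realFourier hui hlam hC hs0 (by push_cast; linarith)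

namespace FourierRegular

variable {α lam : ℝ} {u : ℝ → ℝ}

theorem integrable_cpow_mul (H : FourierRegular α lam u) {s : ℝ} (hs0 : 0 ≤ s) (hs : s ≤ α + 4) :
    Integrable (fun ω => bromwich lam ω ^ (s : ℂ) * realFourier u ω) := by
  refine (H.integrable_bromwich s hs0 hs).mono' ?_ (Filter.Eventually.of_forall fun ω => ?_)
  · exact ((measurable_bromwich_cpow lam s).mul
      (continuous_realFourier H.integrable).measurable).aestronglyMeasurable
  · rw [norm_mul, Complex.norm_cpow_real]

theorem integrable_cpow_sub_two_mul (H : FourierRegular α lam u) (hα2 : α ≤ 2) :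
    Integrable (fun ω => bromwich lam ω ^ ((α - 2 : ℝ) : ℂ) * realFourier u ω) := by
  refine H.integrable_singular.mono' ?_ ?_
  · exact ((measurable_bromwich_cpow lam _).mul
      (continuous_realFourier H.integrable).measurable).aestronglyMeasurable
  · filter_upwards [ae_ne_zero_real] with ω hω
    have h := norm_bromwich_cpow_neg_le lam (s := 2 - α) (by linarith) hω
    rw [norm_mul]
    refine mul_le_mul_of_nonneg_right ?_ (norm_nonneg _)
    rw [← Complex.ofReal_neg, neg_sub] at h
    exact h

theorem integrable_mul_cexp {G : ℝ → ℂ} (hG : Integrable G) (lam x : ℝ) :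
    Integrable (fun ω => G ω * Complex.exp (bromwich lam ω * x)) := by
  refine hG.mul_bdd (c := Real.exp (lam * x)) ?_ (Filter.Eventually.of_forall fun ω => ?_)
  · have := continuous_bromwich lam
    exact Continuous.aestronglyMeasurable (by fun_prop)
  · rw [norm_cexp_bromwich_mul]

variable (hα1 : 1 < α) (hα2 : α < 2) (hlam : 0 ≤ lam)
include hα1 hα2 hlam

theorem hasDerivAt_rlIntegral (H : FourierRegular α lam u) (x : ℝ) :
    HasDerivAt (rlIntegral α (expMul lam u))
      (Real.Gamma (2 - α) * (bromwichIntegral lam (α - 1) u x).re) x := by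
  have h1 : rlIntegral α (expMul lam u) =
      fun x => Real.Gamma (2 - α) * (bromwichIntegral lam (α - 2) u x).re :=
    funext fun x => rlIntegral_eq_bromwichIntegral hα1 hα2 H.continuous H.integrable
      H.integrable_fourier H.integrable_singular hlam x
  have h := hasDerivAt_bromwichIntegral hlam (H.integrable_cpow_sub_two_mul hα2.le)
    (by
      rw [show α - 2 + 1 = α - 1 by ring]
      exact H.integrable_cpow_mul (s := α - 1) (by linarith) (by linarith)) x
  rw [show α - 2 + 1 = α - 1 by ring] at h
  rw [h1]
  exact h.const_mul _

theorem hasDerivAt_deriv_rlIntegral (H : FourierRegular α lam u) (x : ℝ) :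
    HasDerivAt (deriv (rlIntegral α (expMul lam u)))
      (Real.Gamma (2 - α) * (bromwichIntegral lam α u x).re) x := by
  have h1 : deriv (rlIntegral α (expMul lam u)) =
      fun x => Real.Gamma (2 - α) * (bromwichIntegral lam (α - 1) u x).re :=
    funext fun x => (H.hasDerivAt_rlIntegral hα1 hα2 hlam x).deriv
  have h := hasDerivAt_bromwichIntegral hlam
    (H.integrable_cpow_mul (s := α - 1) (by linarith) (by linarith))
    (by
      rw [sub_add_cancel]
      exact H.integrable_cpow_mul (by linarith) (by linarith)) x
  rw [sub_add_cancel] at h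
  rw [h1]
  exact h.const_mul _

theorem leftRLExists (H : FourierRegular α lam u) : LeftRLExists α (expMul lam u) := by
  refine ⟨integrableOn_rlIntegrand hα1 hα2 hlam H.continuous H.integrable
    (abs_le_integral_norm_realFourier H.continuous H.integrable H.integrable_fourier), ?_⟩
  intro m hm
  rw [rlOrder_eq_two hα1 hα2] at hm
  interval_cases m
  · rw [iteratedDeriv_zero]
    exact fun x => (H.hasDerivAt_rlIntegral hα1 hα2 hlam x).differentiableAt
  · rw [iteratedDeriv_one]
    exact fun x => (H.hasDerivAt_deriv_rlIntegral hα1 hα2 hlam x).differentiableAt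

theorem expMul_leftTemperedRL (H : FourierRegular α lam u) (x : ℝ) :
    expMul lam (leftTemperedRL α lam u) x = (bromwichIntegral lam α u x).re := by
  unfold expMul leftTemperedRL leftRL
  rw [rlOrder_eq_two hα1 hα2, iteratedDeriv_succ, iteratedDeriv_one,
    (H.hasDerivAt_deriv_rlIntegral hα1 hα2 hlam x).deriv, ← mul_assoc, ← Real.exp_add]
  have hΓ : Real.Gamma (2 - α) ≠ 0 := (Real.Gamma_pos_of_pos (by linarith)).ne'
  push_cast
  rw [show lam * x + -lam * x = 0 by ring, Real.exp_zero]
  field_simp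

/-- The tempered Grünwald series as a Fourier multiplier. -/
theorem hasSum_grunwaldTerm (H : FourierRegular α lam u) (p : ℤ) {h : ℝ} (hh : 0 < h) (x : ℝ) :
    HasSum (fun k => ((Real.exp (lam * x) * grunwaldTerm α lam h p u x k : ℝ) : ℂ))
      (∫ ω, (Complex.exp (p * (bromwich lam ω * h)) *
        (1 - Complex.exp (-(bromwich lam ω * h))) ^ (α : ℂ)) * realFourier u ω *
          Complex.exp (bromwich lam ω * x)) := by
  set F : ℕ → ℝ → ℂ := fun k ω => (grunwaldWeight α k : ℂ) *
    (realFourier u ω * Complex.exp (bromwich lam ω * ((x - ((k : ℝ) - (p : ℝ)) * h : ℝ) : ℂ)))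
    with hF
  have hFint : ∀ k, Integrable (F k) := fun k =>
    (integrable_mul_cexp H.integrable_fourier lam _).const_mul _
  -- Since `lam ≥ 0`, the damping `e^{-λkh}` is at most 1 and can be dropped; summability then comes
  -- from the weights alone.
  have hFnorm : ∀ k ω, ‖F k ω‖ ≤
      |grunwaldWeight α k| * (‖realFourier u ω‖ * Real.exp (lam * (x + p * h))) := by
    intro k ω
    rw [hF, norm_mul, norm_mul, Complex.norm_real, norm_cexp_bromwich_mul, Real.norm_eq_abs]
    gcongr
    have : 0 ≤ (k : ℝ) * h := by positivity
    linarith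
  have hsum : Summable (fun k => ∫ ω, ‖F k ω‖) := by
    refine Summable.of_nonneg_of_le (fun k => integral_nonneg fun _ => norm_nonneg _)
      (fun k => ?_) ((summable_grunwaldWeight hα1 hα2).mul_right
        (∫ ω, ‖realFourier u ω‖ * Real.exp (lam * (x + p * h))))
    rw [← integral_const_mul]
    exact integral_mono (hFint k).norm
      ((H.integrable_fourier.norm.mul_const _).const_mul _) (hFnorm k)
  have hs := hasSum_integral_of_summable_integral_norm hFint hsum
  have e1 : (fun k => ((Real.exp (lam * x) * grunwaldTerm α lam h p u x k : ℝ) : ℂ)) =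
      fun k => ∫ ω, F k ω := by
    funext k
    rw [hF, integral_const_mul, grunwaldTerm]
    have h1 := eq_integral_realFourier H.continuous H.integrable H.integrable_fourier
      (x - ((k : ℝ) - (p : ℝ)) * h)
    have h2 : ∫ ω, realFourier u ω *
        Complex.exp (bromwich lam ω * ((x - ((k : ℝ) - (p : ℝ)) * h : ℝ) : ℂ)) =
        Complex.exp (lam * ((x - ((k : ℝ) - (p : ℝ)) * h : ℝ) : ℂ)) *
          u (x - ((k : ℝ) - (p : ℝ)) * h) := by
      rw [h1, ← integral_const_mul]
      congr 1
      ext ω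
      rw [bromwich_add_real lam, add_mul, Complex.exp_add]
      ring
    rw [h2]
    push_cast
    rw [show (lam : ℂ) * (x - ((k : ℂ) - p) * h) = lam * x + -((k : ℂ) - p) * lam * h by ring,
      Complex.exp_add]
    ring
  have e2 : (∫ ω, (Complex.exp (p * (bromwich lam ω * h)) *
      (1 - Complex.exp (-(bromwich lam ω * h))) ^ (α : ℂ)) * realFourier u ω *
        Complex.exp (bromwich lam ω * x)) = ∫ ω, ∑' k, F k ω := by
    congr 1
    funext ω
    -- The modulus is `e^{-λh}`, which equals 1 when `lam = 0`: the generating function is needed on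
    -- the closed disc.
    have hw : ‖Complex.exp (-(bromwich lam ω * h))‖ ≤ 1 := by
      rw [Complex.norm_exp, Complex.neg_re, Complex.re_mul_ofReal, bromwich_re]
      exact Real.exp_le_one_iff.2 (by nlinarith)
    have hg := (hasSum_grunwaldWeight_mul_pow hα1 hα2 hw).mul_left
      (Complex.exp (p * (bromwich lam ω * h)) * realFourier u ω * Complex.exp (bromwich lam ω * x))
    rw [show (Complex.exp (p * (bromwich lam ω * h)) *
        (1 - Complex.exp (-(bromwich lam ω * h))) ^ (α : ℂ)) * realFourier u ω *
          Complex.exp (bromwich lam ω * x) = Complex.exp (p * (bromwich lam ω * h)) *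
          realFourier u ω * Complex.exp (bromwich lam ω * x) *
          (1 - Complex.exp (-(bromwich lam ω * h))) ^ (α : ℂ) by ring, ← hg.tsum_eq]
    congr 1
    ext k
    rw [hF]
    push_cast
    rw [show bromwich lam ω * (x - ((k : ℂ) - p) * h) = bromwich lam ω * x +
      p * (bromwich lam ω * h) + k * (-(bromwich lam ω * h)) by ring, Complex.exp_add,
      Complex.exp_add, Complex.exp_nat_mul]
    ring
  rw [e1, e2]
  exact hs

theorem summable_grunwaldTerm (H : FourierRegular α lam u) (p : ℤ) {h : ℝ} (hh : 0 < h) (x : ℝ) :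
    Summable (grunwaldTerm α lam h p u x) := by
  have hs := (H.hasSum_grunwaldTerm hα1 hα2 hlam p hh x).summable
  rw [Complex.summable_ofReal] at hs
  exact (summable_mul_left_iff (Real.exp_pos _).ne').1 hs

theorem exp_mul_temperedGrunwald (H : FourierRegular α lam u) (p : ℤ) {h : ℝ} (hh : 0 < h)
    (x : ℝ) : ((Real.exp (lam * x) * temperedGrunwald α lam h p u x : ℝ) : ℂ) =
      ((h ^ α)⁻¹ : ℝ) * ∫ ω, (Complex.exp (p * (bromwich lam ω * h)) *
        (1 - Complex.exp (-(bromwich lam ω * h))) ^ (α : ℂ)) * realFourier u ω *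
          Complex.exp (bromwich lam ω * x) := by
  rw [← (H.hasSum_grunwaldTerm hα1 hα2 hlam p hh x).tsum_eq, ← Complex.ofReal_tsum, tsum_mul_left,
    ← Complex.ofReal_mul, temperedGrunwald]
  congr 1
  ring

theorem integrable_grunwald (H : FourierRegular α lam u) (p : ℤ) {h : ℝ} (hh : 0 < h) (x : ℝ) :
    Integrable (fun ω => (Complex.exp (p * (bromwich lam ω * h)) *
        (1 - Complex.exp (-(bromwich lam ω * h))) ^ (α : ℂ)) * realFourier u ω *
          Complex.exp (bromwich lam ω * x)) := by
  refine integrable_mul_cexp ?_ lam x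
  refine H.integrable_fourier.bdd_mul (c := Real.exp (p * (lam * h)) * 2 ^ α) ?_
    (Filter.Eventually.of_forall fun ω => ?_)
  · have := (continuous_bromwich lam).measurable
    exact Measurable.aestronglyMeasurable (by fun_prop)
  · rw [norm_mul, Complex.norm_cpow_real, Complex.norm_exp]
    have h1 : ((p : ℂ) * (bromwich lam ω * h)).re = p * (lam * h) := by
      rw [← Complex.ofReal_intCast, Complex.re_ofReal_mul, Complex.re_mul_ofReal, bromwich_re]
    have h2 : ‖Complex.exp (-(bromwich lam ω * h))‖ ≤ 1 := by
      rw [Complex.norm_exp, Complex.neg_re, Complex.re_mul_ofReal, bromwich_re]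
      exact Real.exp_le_one_iff.2 (by nlinarith)
    rw [h1]
    gcongr
    refine (norm_sub_le _ _).trans ?_
    rw [norm_one]
    linarith

/-- The scheme error as a Fourier multiplier. -/
theorem exp_mul_error (H : FourierRegular α lam u) {h : ℝ} (hh : 0 < h) (x : ℝ) :
    Real.exp (lam * x) * (temperedP α lam h (leftTemperedRL α lam u) x -
        (coeffMuOne α * temperedGrunwald α lam h 1 u x +
          coeffMuZero α * temperedGrunwald α lam h 0 u x +
          coeffMuNegOne α * temperedGrunwald α lam h (-1) u x)) =
      (∫ ω, ((h ^ α)⁻¹ : ℝ) * quasiCompactSymbol α (bromwich lam ω * h) * realFourier u ω *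
        Complex.exp (bromwich lam ω * x)).re := by
  have hI : ∀ y : ℝ, Integrable (fun ω => bromwich lam ω ^ (α : ℂ) * realFourier u ω *
      Complex.exp (bromwich lam ω * y)) := fun y =>
    integrable_mul_cexp (H.integrable_cpow_mul (by linarith) (by linarith)) lam y
  have hJ : ∀ p : ℤ, _ := fun p : ℤ => H.integrable_grunwald hα1 hα2 hlam p hh x
  have hhα : (h ^ α : ℝ) ≠ 0 := (Real.rpow_pos_of_pos hh _).ne'
  have hP : Real.exp (lam * x) * temperedP α lam h (leftTemperedRL α lam u) x =
      (bromwichIntegral lam α u x + coeffB α * (bromwichIntegral lam α u (x - h) -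
        2 * bromwichIntegral lam α u x + bromwichIntegral lam α u (x + h))).re := by
    unfold temperedP centeredDiff
    rw [H.expMul_leftTemperedRL hα1 hα2 hlam, H.expMul_leftTemperedRL hα1 hα2 hlam,
      H.expMul_leftTemperedRL hα1 hα2 hlam, mul_add, ← expMul,
      H.expMul_leftTemperedRL hα1 hα2 hlam]
    have he : Real.exp (lam * x) * Real.exp (-lam * x) = 1 := by
      rw [← Real.exp_add, show lam * x + -lam * x = 0 by ring, Real.exp_zero]
    have hcd : ∀ E E' b X : ℝ, E * E' = 1 → E * (h ^ 2 * b * E' * (X / h ^ 2)) = b * X := by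
      intro E E' b X hE
      field_simp
      linear_combination b * X * hE
    rw [hcd _ _ _ _ he, Complex.add_re, Complex.re_ofReal_mul]
    simp
  have hG : ∀ p : ℤ, Real.exp (lam * x) * temperedGrunwald α lam h p u x =
      (((h ^ α)⁻¹ : ℝ) * ∫ ω, (Complex.exp (p * (bromwich lam ω * h)) *
        (1 - Complex.exp (-(bromwich lam ω * h))) ^ (α : ℂ)) * realFourier u ω *
          Complex.exp (bromwich lam ω * x)).re := fun p => by
    rw [← H.exp_mul_temperedGrunwald hα1 hα2 hlam p hh x, Complex.ofReal_re]
  have hcomb : (∫ ω, ((h ^ α)⁻¹ : ℝ) * quasiCompactSymbol α (bromwich lam ω * h) *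
      realFourier u ω * Complex.exp (bromwich lam ω * x)) =
      (bromwichIntegral lam α u x + coeffB α * (bromwichIntegral lam α u (x - h) -
        2 * bromwichIntegral lam α u x + bromwichIntegral lam α u (x + h))) -
      (coeffMuOne α * (((h ^ α)⁻¹ : ℝ) * ∫ ω, (Complex.exp ((1 : ℤ) * (bromwich lam ω * h)) *
        (1 - Complex.exp (-(bromwich lam ω * h))) ^ (α : ℂ)) * realFourier u ω *
          Complex.exp (bromwich lam ω * x)) +
      coeffMuZero α * (((h ^ α)⁻¹ : ℝ) * ∫ ω, (Complex.exp ((0 : ℤ) * (bromwich lam ω * h)) *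
        (1 - Complex.exp (-(bromwich lam ω * h))) ^ (α : ℂ)) * realFourier u ω *
          Complex.exp (bromwich lam ω * x)) +
      coeffMuNegOne α * (((h ^ α)⁻¹ : ℝ) * ∫ ω, (Complex.exp ((-1 : ℤ) * (bromwich lam ω * h)) *
        (1 - Complex.exp (-(bromwich lam ω * h))) ^ (α : ℂ)) * realFourier u ω *
          Complex.exp (bromwich lam ω * x))) := by
    unfold bromwichIntegral
    rw [← integral_scheme_combination (hI (x - h)) (hI x) (hI (x + h)) (hJ 1) (hJ 0) (hJ (-1))]
    congr 1
    ext ω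
    -- Homogeneity of the power cancels the prefactor `h^{-α}` in the derivative part of the symbol.
    have hz : (bromwich lam ω * h) ^ (α : ℂ) = bromwich lam ω ^ (α : ℂ) * ((h ^ α : ℝ) : ℂ) := by
      rw [mul_ofReal_cpow (by linarith) hh]
    have hc : ((h ^ α : ℝ) : ℂ) ≠ 0 := by exact_mod_cast hhα
    unfold quasiCompactSymbol
    rw [hz]
    push_cast
    rw [show bromwich lam ω * ((x : ℂ) - h) = bromwich lam ω * x + -(bromwich lam ω * h) by ring,
      show bromwich lam ω * ((x : ℂ) + h) = bromwich lam ω * x + bromwich lam ω * h by ring,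
      Complex.exp_add, Complex.exp_add, one_mul, zero_mul, neg_one_mul, Complex.exp_zero]
    field_simp
    ring
  rw [mul_sub, mul_add, mul_add, mul_left_comm _ (coeffMuOne α), mul_left_comm _ (coeffMuZero α),
    mul_left_comm _ (coeffMuNegOne α), hP, hG, hG, hG, hcomb]
  simp only [Complex.sub_re, Complex.add_re, Complex.re_ofReal_mul]

theorem error_bound (H : FourierRegular α lam u) : ∃ C : ℝ, ∀ h : ℝ, 0 < h → h ≤ 1 → ∀ x : ℝ,
    |temperedP α lam h (leftTemperedRL α lam u) x -
        (coeffMuOne α * temperedGrunwald α lam h 1 u x +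
          coeffMuZero α * temperedGrunwald α lam h 0 u x +
          coeffMuNegOne α * temperedGrunwald α lam h (-1) u x)| ≤ C * h ^ 4 := by
  obtain ⟨C, hC⟩ := quasiCompactSymbol_bound (α := α) (by linarith) lam
  refine ⟨C * ∫ ω, ‖bromwich lam ω‖ ^ (α + 4) * ‖realFourier u ω‖, fun h hh hh1 x => ?_⟩
  have he := Real.exp_pos (lam * x)
  have hint := H.integrable_bromwich (α + 4) (by linarith) le_rfl
  -- Both sides are multiplied by `e^{λx}`, the modulus of the kernel `e^{zx}`; its cancellation
  -- gives uniformity in `x`.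
  refine le_of_mul_le_mul_left ?_ he
  rw [← abs_of_pos he, ← abs_mul, abs_of_pos he, H.exp_mul_error hα1 hα2 hlam hh x]
  refine (Complex.abs_re_le_norm _).trans ?_
  calc _ ≤ ∫ ω, (C * h ^ 4 * Real.exp (lam * x)) *
        (‖bromwich lam ω‖ ^ (α + 4) * ‖realFourier u ω‖) := by
        refine norm_integral_le_of_norm_le (hint.const_mul _)
          (Filter.Eventually.of_forall fun ω => ?_)
        have hr : (bromwich lam ω * h).re = lam * h := by
          rw [Complex.re_mul_ofReal, bromwich_re]
        -- `h ≤ 1` keeps `Re (zh) = λh` in the strip `[0, λ]`.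
        have h1 := hC (bromwich lam ω * h) (by rw [hr]; positivity) (by rw [hr]; nlinarith)
        have hpos : 0 < h ^ α := Real.rpow_pos_of_pos hh _
        have h4 : h ^ (4 : ℝ) = h ^ 4 := by exact_mod_cast Real.rpow_natCast h 4
        rw [norm_mul, Complex.norm_real, Real.norm_of_nonneg hh.le,
          Real.mul_rpow (norm_nonneg _) hh.le, Real.rpow_add hh α 4, h4] at h1
        rw [norm_mul, norm_mul, norm_mul, norm_cexp_bromwich_mul, Complex.norm_real,
          Real.norm_of_nonneg (inv_pos.2 hpos).le]
        calc (h ^ α)⁻¹ * ‖quasiCompactSymbol α (bromwich lam ω * h)‖ * ‖realFourier u ω‖ *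
              Real.exp (lam * x)
            ≤ (h ^ α)⁻¹ * (C * (‖bromwich lam ω‖ ^ (α + 4) * (h ^ α * h ^ 4))) *
              ‖realFourier u ω‖ * Real.exp (lam * x) := by gcongr
          _ = _ := by field_simp
    _ = _ := by rw [integral_const_mul]; ring

end FourierRegular

end

theorem mainTheorem7 (α lam : ℝ) (hα1 : 1 < α) (hα2 : α < 2) (hlam : 0 ≤ lam)
    (u : ℝ → ℝ) (hu : ContDiff ℝ 7 u)
    (hL1 : ∀ k : ℕ, k ≤ 7 → Integrable (iteratedDeriv k u)) :
    LeftRLExists α (expMul lam u) ∧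
    (∀ (p : ℤ) (h x : ℝ), 0 < h → Summable (grunwaldTerm α lam h p u x)) ∧
    ∃ C h₀ : ℝ, 0 < h₀ ∧ ∀ h : ℝ, 0 < h → h ≤ h₀ → ∀ x : ℝ,
      |temperedP α lam h (leftTemperedRL α lam u) x -
        (coeffMuOne α * temperedGrunwald α lam h 1 u x +
          coeffMuZero α * temperedGrunwald α lam h 0 u x +
          coeffMuNegOne α * temperedGrunwald α lam h (-1) u x)| ≤ C * h ^ 4 := by
  have H := fourierRegular_of_contDiff hα1 hα2 hlam hu hL1
  obtain ⟨C, hC⟩ := H.error_bound hα1 hα2 hlam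
  exact ⟨H.leftRLExists hα1 hα2 hlam,
    fun p h x hh => H.summable_grunwaldTerm hα1 hα2 hlam p hh x, C, 1, one_pos, hC⟩
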